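/- Let $Y$ be a smooth scheme of finite type over $\mathbb{C}$ of pure dimension $n$ (a nonsingular complex variety, not necessarily connected). A $k$-jet of $Y$ is a $\mathbb{C}$-morphism $\operatorname{Spec}\mathbb{C}[z]/(z^{k+1})\to Y$ and a formal arc is a $\mathbb{C}$-morphism $\operatorname{Spec}\mathbb{C}[[z]]\to Y$. Let $J_k(Y)$ be the variety of $k$-jets (over an open $U\subseteq Y$ its regular functions are generated by the coefficients, in degrees $0,\dots,k$, of the expansions along jets of regular functions on $U$), $J_\infty(Y)$ the set of formal arcs, $\pi_k\colon J_\infty(Y)\to J_k(Y)$ the truncation and $\pi_0\colon J_\infty(Y)\to J_0(Y)=Y$ the base point map. A set $C\subseteq J_\infty(Y)$ is a *cylinder set* if $C=\pi_k^{-1}(B)$ for some $k\ge 0$ and some constructible $B\subseteq J_k(Y)$, that is, a finite disjoint union of Zariski locally closed subsets. Let $D=\sum_{i=1}^r a_iD_i$ (with $D_i$ distinct prime divisors, $a_i\ge 1$) be an effective divisor on $Y$. For an arc $\gamma$, let $F_D(\gamma)\in\mathbb{Z}_{\ge 0}\cup\{\infty\}$ be the order of vanishing at $z=0$ of $g(\gamma(z))$,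 where $g$ is a local defining equation of $D$ near the base point of $\gamma$; similarly for $F_{D_i}$. Suppose that $D$ has simple normal crossings: every point of $Y$ has a Zariski open neighbourhood $U$ with coordinates $z_1,\dots,z_n$ (functions on $U$ defining an étale map $U\to\mathbb{A}^n$) and an injection $e$ from the set of those $i$ with $D_i\cap U\ne\emptyset$ to $\{1,\dots,n\}$, such that $D_i$ is defined on $U$ by $z_{e(i)}=0$; thus $\prod z_{e(i)}^{a_i}$ is an equation of $D$ on $U$. Call such a triple $(U,z,e)$ an adapted chart. Then: 1. For every $s\in\mathbb{Z}_{\ge 0}$ the level set $F_D^{-1}(s)$ is a cylinder set in $J_\infty(Y)$. For all $m_1,\dots,m_r\in\mathbb{Z}_{\ge 0}$ the set $\bigcap_{i}F_{D_i}^{-1}(m_i)$ is a cylinder set. 2. Let $(U,z,e)$ be any adapted chart. For every $t\ge 0$, sending a jet to its base point and the coefficients in degrees $1,\dots,t$ of $z_1,\dots,z_n$ along it is an isomorphism of varieties $J_t(U)\cong U\times\mathbb{C}^{tn}$. Let $m_1,\dots,m_r\in\mathbb{Z}_{\ge 0}$, $J=\{i: m_i>0\}$, $D_J^\circ=\bigcap_{j\in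 J}D_j\setminus\bigcup_{i\notin J}D_i$ (with $\bigcap_{j\in\emptyset}D_j=Y$), and let $t\ge m_i$ for all $i$ (for example $t=\max_{j\in J} m_j$). If $U\cap D_J^\circ\neq\emptyset$ then $\sum_{j\in J} m_j\le tn$. There are a constructible set $B\subseteq J_t(U)$ with $$\pi_0^{-1}(U)\cap\bigcap_{i}F_{D_i}^{-1}(m_i)=\pi_t^{-1}(B)$$ and an isomorphism of varieties $$B\;\cong\;(U\cap D_J^\circ)\times\mathbb{C}^{\,tn-\sum_{j\in J}m_j}\times(\mathbb{C}^*)^{|J|}$$ (both sides being empty if $U\cap D_J^\circ=\emptyset$). Its first component is the base point, each component in $\mathbb{C}^{\,tn-\sum m_j}$ is one of the coordinates of $J_t(U)\cong U\times\mathbb{C}^{tn}$, and its component in $\mathbb{C}^*$ for $j\in J$ is the coefficient of $z_{e(j)}$ in degree $m_j$. -/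

import Mathlib

open AlgebraicGeometry CategoryTheory TopologicalSpace
open scoped Topology PowerSeries

noncomputable section

namespace ArcSpace

/-! ### Sets with regular functions (classical complex varieties) -/

/-- Zariski charts on a set `X`: a chart `(V, G)` consists of a subset `V` of `X` and a set `G` of
functions which generate a `ℂ`-algebra of regular functions on `V` (their values outside `V` are
irrelevant). -/
class ZariskiCharts (X : Type) where
  charts : Set (Set X × Set (X → ℂ))

/-- The Zariski topology: generated by the loci in a chart where a polynomial in the
generating functions does not vanish. -/
@[reducible] def zariski (X : Type) [ZariskiCharts X] : TopologicalSpace X :=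
  TopologicalSpace.generateFrom
    {W | ∃ c ∈ ZariskiCharts.charts (X := X), ∃ p ∈ Algebra.adjoin ℂ c.2,
      W = {x | x ∈ c.1 ∧ p x ≠ 0}}

/-- `f` is a regular function on the subset `S` of `X`: near each point of `S` it is a quotient of
polynomials in the generating functions of a chart. -/
def IsRegularOn {X : Type} [ZariskiCharts X] (S : Set X) (f : X → ℂ) : Prop :=
  ∀ x ∈ S, ∃ c ∈ ZariskiCharts.charts (X := X), x ∈ c.1 ∧
    ∃ p ∈ Algebra.adjoin ℂ c.2, ∃ q ∈ Algebra.adjoin ℂ c.2, q x ≠ 0 ∧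
      ∀ x' ∈ S ∩ c.1, q x' ≠ 0 → f x' = p x' / q x'

/-- `φ` restricts to a morphism of varieties `S → T`: it is continuous for the Zariski topologies
and pulls regular functions on open subsets back to regular functions. -/
structure IsMorphismOn {X X' : Type} [ZariskiCharts X] [ZariskiCharts X'] (φ : X → X')
    (S : Set X) (T : Set X') : Prop where
  mapsTo : Set.MapsTo φ S T
  continuousOn : ∀ W : Set X', IsOpen[zariski X'] W →
    ∃ W₀ : Set X, IsOpen[zariski X] W₀ ∧ S ∩ φ ⁻¹' W = S ∩ W₀
  isRegularOn : ∀ W : Set X', IsOpen[zariski X'] W → ∀ f : X' → ℂ,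
    IsRegularOn (T ∩ W) f → IsRegularOn (S ∩ φ ⁻¹' W) (f ∘ φ)

/-- `φ` restricts to an isomorphism of varieties `S ≅ T`. -/
def IsIsoOn {X X' : Type} [ZariskiCharts X] [ZariskiCharts X'] (φ : X → X')
    (S : Set X) (T : Set X') : Prop :=
  IsMorphismOn φ S T ∧ ∃ ψ : X' → X, IsMorphismOn ψ T S ∧ Set.InvOn ψ φ S T

/-- Locally closed subset for the Zariski topology. -/
def IsZariskiLocallyClosed {X : Type} [ZariskiCharts X] (S : Set X) : Prop :=
  ∃ O C : Set X, IsOpen[zariski X] O ∧ IsClosed[zariski X] C ∧ S = O ∩ C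

/-- A constructible subset: a finite disjoint union of Zariski locally closed subsets. -/
def IsConstructibleSet {X : Type} [ZariskiCharts X] (B : Set X) : Prop :=
  ∃ F : Set (Set X), F.Finite ∧ F.PairwiseDisjoint id ∧
    (∀ S ∈ F, IsZariskiLocallyClosed S) ∧ ⋃₀ F = B

/-- Affine space `ℂ^ι` with its coordinate functions. -/
instance affineCharts (ι : Type) : ZariskiCharts (ι → ℂ) where
  charts := {(Set.univ, {f | ∃ i, f = fun x => x i})}

/-- The product of two varieties. -/
instance prodCharts (X X' : Type) [ZariskiCharts X] [ZariskiCharts X'] :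
    ZariskiCharts (X × X') where
  charts := {c | ∃ a ∈ ZariskiCharts.charts (X := X), ∃ b ∈ ZariskiCharts.charts (X := X'),
    c = (a.1 ×ˢ b.1, {f | ∃ g ∈ a.2, f = fun x => g x.1} ∪ {f | ∃ g ∈ b.2, f = fun x => g x.2})}

/-! ### Points with values in a local `ℂ`-algebra; arcs and jets -/

section Points

variable (Y : Scheme.{0}) [Y.Over (Spec (.of ℂ))]

/-- The `R`-valued points of the `ℂ`-scheme `Y`: morphisms `Spec R ⟶ Y` over `Spec ℂ`. -/
def Points (R : Type) [CommRing R] [Algebra ℂ R] : Type :=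
  {γ : Spec (.of R) ⟶ Y //
    γ ≫ (Y ↘ Spec (.of ℂ)) = Spec.map (CommRingCat.ofHom (algebraMap ℂ R))}

variable {Y}

/-- Functoriality of `R`-valued points in `R`. -/
def Points.map {R R' : Type} [CommRing R] [Algebra ℂ R] [CommRing R'] [Algebra ℂ R']
    (φ : R →ₐ[ℂ] R') (γ : Points Y R) : Points Y R' :=
  ⟨Spec.map (CommRingCat.ofHom φ.toRingHom) ≫ γ.1, by
    rw [Category.assoc, γ.2, ← Spec.map_comp, ← CommRingCat.ofHom_comp]
    congr 2
    exact φ.comp_algebraMap⟩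

/-- The point of `Y` over which an `R`-valued point lies, `R` being local: the image of the closed
point of `Spec R`. -/
def Points.base {R : Type} [CommRing R] [IsLocalRing R] [Algebra ℂ R] (γ : Points Y R) : Y :=
  γ.1 (IsLocalRing.closedPoint R)

/-- The pullback `f ↦ γ^* f ∈ R` of functions on an open neighbourhood `U` of the base point. -/
def Points.pull {R : Type} [CommRing R] [IsLocalRing R] [Algebra ℂ R] (γ : Points Y R)
    (U : Y.Opens) (hU : γ.base ∈ U) : Γ(Y, U) →+* R :=
  (Scheme.stalkClosedPointTo γ.1).hom.comp (Y.presheaf.germ U γ.base hU).hom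

variable (Y)

/-- The closed points of `Y`, as `ℂ`-valued points. -/
abbrev CPoint : Type := Points Y ℂ

/-- The formal arcs `Spec ℂ⟦z⟧ ⟶ Y`. -/
abbrev Arc : Type := Points Y ℂ⟦X⟧

/-- The ring `ℂ[z]/(z^(k+1))`, written as a quotient of `ℂ⟦z⟧`. -/
abbrev JetRing (k : ℕ) : Type := ℂ⟦X⟧ ⧸ Ideal.span {(PowerSeries.X : ℂ⟦X⟧) ^ (k + 1)}

instance (k : ℕ) : Nontrivial (JetRing k) := by
  refine Ideal.Quotient.nontrivial_iff.mpr fun h => ?_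
  have h1 := (Ideal.eq_top_iff_one _).mp h
  rw [Ideal.mem_span_singleton, PowerSeries.X_pow_dvd_iff] at h1
  simpa using h1 0 (Nat.succ_pos k)

instance (k : ℕ) : IsLocalRing (JetRing k) :=
  IsLocalRing.of_surjective' (Ideal.Quotient.mk _) Ideal.Quotient.mk_surjective

/-- The `i`-th coefficient of an element of `ℂ[z]/(z^(k+1))`, for `i ≤ k`. -/
def jetCoeff (k i : ℕ) (h : i ≤ k) : JetRing k →ₗ[ℂ] ℂ :=
  Submodule.liftQ ((Ideal.span {(PowerSeries.X : ℂ⟦X⟧) ^ (k + 1)}).restrictScalars ℂ)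
    (PowerSeries.coeff i) (by
      intro f hf
      rw [Submodule.restrictScalars_mem, Ideal.mem_span_singleton,
        PowerSeries.X_pow_dvd_iff] at hf
      exact hf i (Nat.lt_succ_of_le h))

/-- The augmentation `ℂ[z]/(z^(k+1)) → ℂ`, `z ↦ 0`. -/
def jetAugmentation (k : ℕ) : JetRing k →ₐ[ℂ] ℂ :=
  { Ideal.Quotient.lift _ (PowerSeries.constantCoeff (R := ℂ)) (by
      intro f hf
      rw [Ideal.mem_span_singleton, PowerSeries.X_pow_dvd_iff] at hf
      simpa using hf 0 (Nat.succ_pos k)) with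
    commutes' := fun r => by
      change PowerSeries.constantCoeff (algebraMap ℂ ℂ⟦X⟧ r) = r
      simp }

/-- The `k`-jets `Spec ℂ[z]/(z^(k+1)) ⟶ Y`. -/
abbrev Jet (k : ℕ) : Type := Points Y (JetRing k)

variable {Y}

/-- The truncation `π_k : J_∞(Y) → J_k(Y)`. -/
def truncArc (k : ℕ) (γ : Arc Y) : Jet Y k := γ.map (Ideal.Quotient.mkₐ ℂ _)

/-- The projection `J_k(Y) → Y`, on closed points. -/
def Jet.point {k : ℕ} (γ : Jet Y k) : CPoint Y := γ.map (jetAugmentation k)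

open Classical in
/-- The value of a function on `U` at a closed point in `U`. -/
def evalFun (U : Y.Opens) (f : Γ(Y, U)) (y : CPoint Y) : ℂ :=
  if h : y.base ∈ U then y.pull U h f else 0

open Classical in
/-- The `i`-th coefficient of the expansion of `f` along a `k`-jet lying over `U`, for `i ≤ k`. -/
def coeffFun {k : ℕ} (U : Y.Opens) (f : Γ(Y, U)) (i : ℕ) (hi : i ≤ k) (γ : Jet Y k) : ℂ :=
  if h : γ.base ∈ U then jetCoeff k i hi (γ.pull U h f) else 0

variable (Y)

/-- The set of closed points of `Y` as a variety. -/
instance pointCharts : ZariskiCharts (CPoint Y) where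
  charts := {c | ∃ U : Y.Opens,
    c = ({y | y.base ∈ U}, {φ | ∃ f : Γ(Y, U), φ = evalFun U f})}

/-- The jet space `J_k(Y)` as a variety: over an open subset `U` of `Y`, the regular functions are
generated by the coefficients `0, …, k` of the expansions of the functions on `U` along jets. -/
instance jetCharts (k : ℕ) : ZariskiCharts (Jet Y k) where
  charts := {c | ∃ U : Y.Opens, c = ({γ | γ.base ∈ U},
    {φ | ∃ (f : Γ(Y, U)) (i : ℕ) (hi : i ≤ k), φ = coeffFun U f i hi})}

variable {Y}

/-- A cylinder set: the preimage under some `π_k` of a constructible subset of `J_k(Y)`. -/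
def IsCylinder (C : Set (Arc Y)) : Prop :=
  ∃ (k : ℕ) (B : Set (Jet Y k)), IsConstructibleSet B ∧ C = truncArc k ⁻¹' B

end Points

/-! ### Divisors -/

/-- A prime divisor of `Y`, given by its generic point, a point of codimension one. -/
def PrimeDivisor (Y : Scheme.{0}) : Type := {y : Y // Order.coheight y = 1}

/-- The underlying closed subset of a prime divisor. -/
def PrimeDivisor.carrier {Y : Scheme.{0}} (P : PrimeDivisor Y) : Closeds Y :=
  Closeds.closure {P.1}

/-- An effective divisor `∑ a_P P`, as a finitely supported function `P ↦ a_P ∈ ℕ`. -/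
abbrev EffDivisor (Y : Scheme.{0}) : Type := PrimeDivisor Y →₀ ℕ

/-- The ideal sheaf `∏ I_P ^ a_P` of an effective divisor, `I_P` being the ideal sheaf of the
functions that vanish on `P`. -/
def EffDivisor.ideal {Y : Scheme.{0}} (D : EffDivisor Y) : Y.IdealSheafData :=
  D.prod fun P a => Scheme.IdealSheafData.vanishingIdeal P.carrier ^ a

/-- `g` is a defining equation of `D` on `U`: it generates the ideal sheaf of `D` on `U`. -/
def IsLocalEquation {Y : Scheme.{0}} (D : EffDivisor Y) (U : Y.Opens) (g : Γ(Y, U)) : Prop :=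
  ∀ (V : Y.affineOpens) (hV : V.1 ≤ U),
    (EffDivisor.ideal D).ideal V = Ideal.span {(Y.presheaf.map (homOfLE hV).op).hom g}

variable {Y : Scheme.{0}} [Y.Over (Spec (.of ℂ))]

/-- The function `F_D` on the arc space: `F_D γ` is the order of vanishing of the power series
`g(γ(z))`, for a defining equation `g` of `D` on a neighbourhood of the base point of `γ`. By
`contactOrder_eq` it does not depend on `g`, so that the infimum is over a single value. -/
def contactOrder (D : EffDivisor Y) (γ : Arc Y) : ℕ∞ :=
  ⨅ (U : Y.Opens) (g : Γ(Y, U)) (hU : γ.base ∈ U) (_ : IsLocalEquation D U g),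
    (γ.pull U hU g).order

theorem Points.pull_map {R : Type} [CommRing R] [IsLocalRing R] [Algebra ℂ R] (γ : Points Y R)
    {U V : Y.Opens} (hVU : V ≤ U) (hV : γ.base ∈ V) (g : Γ(Y, U)) :
    γ.pull V hV ((Y.presheaf.map (homOfLE hVU).op).hom g) = γ.pull U (hVU hV) g := by
  refine congrArg (Scheme.stalkClosedPointTo γ.1).hom ?_
  exact TopCat.Presheaf.germ_res_apply Y.presheaf (homOfLE hVU) γ.base hV g

theorem order_pull_le {D : EffDivisor Y} (γ : Arc Y) {U U' : Y.Opens} {g : Γ(Y, U)}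
    {g' : Γ(Y, U')} (hU : γ.base ∈ U) (hU' : γ.base ∈ U') (h : IsLocalEquation D U g)
    (h' : IsLocalEquation D U' g') : (γ.pull U hU g).order ≤ (γ.pull U' hU' g').order := by
  obtain ⟨V, hV, hxV, hVU⟩ := Y.isBasis_affineOpens.exists_subset_of_mem_open
    (show γ.base ∈ ((U ⊓ U' : Y.Opens) : Set Y) from ⟨hU, hU'⟩) (U ⊓ U').2
  obtain ⟨V, hVaff, rfl⟩ := hV
  have hV1 : V ≤ U := fun x hx => (hVU hx).1
  have hV2 : V ≤ U' := fun x hx => (hVU hx).2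
  have e := (h ⟨V, hVaff⟩ hV1).symm.trans (h' ⟨V, hVaff⟩ hV2)
  obtain ⟨a, ha⟩ := Ideal.mem_span_singleton.mp
    (e ▸ Ideal.mem_span_singleton_self ((Y.presheaf.map (homOfLE hV2).op).hom g'))
  rw [← γ.pull_map hV1 hxV g, ← γ.pull_map hV2 hxV g', ha]
  rw [map_mul, PowerSeries.order_mul]
  exact le_self_add

/-- `F_D γ` is the order of vanishing of `g(γ(z))` for every local equation `g` of `D`. -/
theorem contactOrder_eq {D : EffDivisor Y} (γ : Arc Y) {U : Y.Opens} {g : Γ(Y, U)}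
    (hU : γ.base ∈ U) (h : IsLocalEquation D U g) :
    contactOrder D γ = (γ.pull U hU g).order := by
  refine le_antisymm ?_ ?_
  · exact iInf_le_of_le U (iInf_le_of_le g (iInf_le_of_le hU (iInf_le _ h)))
  · exact le_iInf fun U' => le_iInf fun g' => le_iInf fun hU' => le_iInf fun h' =>
      order_pull_le γ hU hU' h h'

/-- Coordinates `z_1, …, z_n` on the open subset `U` of the `n`-dimensional `Y`: functions on `U`
that define an étale morphism `U ⟶ 𝔸ⁿ` over `ℂ`. -/
def IsCoordinateSystem {n : ℕ} (U : Y.Opens) (z : Fin n → Γ(Y, U)) : Prop :=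
  Etale (AffineSpace.homOfVector (U.ι ≫ (Y ↘ Spec (.of ℂ))) fun i => U.topIso.inv.hom (z i))

/-- A chart of `Y` on which `D = ∑ a_P P` has the equation `∏ z_{e(P)} ^ a_P`: coordinates
`z_1, …, z_n` on `U` and an injection `e` from the set of those components `P` of `D` which meet `U`
to the set of coordinates such that `P` is cut out on `U` by `z_{e(P)}`. -/
structure SNCChart (n : ℕ) (D : EffDivisor Y) where
  U : Y.Opens
  z : Fin n → Γ(Y, U)
  coord : IsCoordinateSystem U z
  e : {P : D.support // ((P.1.carrier : Set Y) ∩ U).Nonempty} ↪ Fin n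
  eqn : ∀ P, IsLocalEquation (Finsupp.single P.1.1 1) U (z (e P))

/-- The divisor `D` on the `n`-dimensional `Y` has simple normal crossings. -/
def IsSNC (n : ℕ) (D : EffDivisor Y) : Prop :=
  ∀ y : Y, ∃ c : SNCChart n D, y ∈ c.U

/-- The trivialization `J_t(U) → U × ℂ^(nt)`: the base point of a jet together with the
coefficients `1, …, t` of the coordinates along it. -/
def SNCChart.trivialization {n : ℕ} {D : EffDivisor Y} (c : SNCChart n D) (t : ℕ) (γ : Jet Y t) :
    CPoint Y × (Fin n × Fin t → ℂ) :=
  (γ.point, fun ik => coeffFun c.U (c.z ik.1) (ik.2 + 1) ik.2.isLt γ)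

/-- The closed points of the open stratum `D_J° = ⋂_{P ∈ J} P ∖ ⋃_{P ∉ J} P`, where `P` runs through
the components of `D`. -/
def openStratum (D : EffDivisor Y) (J : Set D.support) : Set (CPoint Y) :=
  {y | ∀ P : D.support, y.base ∈ P.1.carrier ↔ P ∈ J}

end ArcSpace

end

open ArcSpace

namespace ArcSpace

/-! ### Sets with regular functions -/

/-- The charts cover `X`, and two charts around a point have a common refinement. -/
class DirectedCharts (X : Type) [ZariskiCharts X] : Prop where
  cover : ∀ x : X, ∃ c ∈ ZariskiCharts.charts (X := X), x ∈ c.1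
  inf : ∀ c ∈ ZariskiCharts.charts (X := X), ∀ d ∈ ZariskiCharts.charts (X := X), ∀ x,
    x ∈ c.1 → x ∈ d.1 → ∃ e ∈ ZariskiCharts.charts (X := X), x ∈ e.1 ∧ e.1 ⊆ c.1 ∧ e.1 ⊆ d.1 ∧
      (∀ g ∈ c.2, ∃ g' ∈ Algebra.adjoin ℂ e.2, Set.EqOn g g' e.1) ∧
      (∀ g ∈ d.2, ∃ g' ∈ Algebra.adjoin ℂ e.2, Set.EqOn g g' e.1)

/-- The nonvanishing locus of `q` in the chart `c`. -/
def chartLocus {X : Type} (c : Set X × Set (X → ℂ)) (q : X → ℂ) : Set X := {x | x ∈ c.1 ∧ q x ≠ 0}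

theorem exists_adjoin_eqOn {X : Type} {s s' : Set (X → ℂ)} {E : Set X}
    (h : ∀ g ∈ s, ∃ g' ∈ Algebra.adjoin ℂ s', Set.EqOn g g' E) {p : X → ℂ}
    (hp : p ∈ Algebra.adjoin ℂ s) : ∃ p' ∈ Algebra.adjoin ℂ s', Set.EqOn p p' E := by
  induction hp using Algebra.adjoin_induction with
  | mem x hx => exact h x hx
  | algebraMap r => exact ⟨_, Subalgebra.algebraMap_mem _ r, fun _ _ => rfl⟩
  | add x y _ _ hx hy =>
    obtain ⟨x', hx', ex⟩ := hx
    obtain ⟨y', hy', ey⟩ := hy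
    exact ⟨_, add_mem hx' hy', fun a ha => by simp [ex ha, ey ha]⟩
  | mul x y _ _ hx hy =>
    obtain ⟨x', hx', ex⟩ := hx
    obtain ⟨y', hy', ey⟩ := hy
    exact ⟨_, mul_mem hx' hy', fun a ha => by simp [ex ha, ey ha]⟩

section Zariski

variable {X X' X'' : Type} [ZariskiCharts X] [ZariskiCharts X'] [ZariskiCharts X'']

theorem isOpen_chartLocus {c : Set X × Set (X → ℂ)} (hc : c ∈ ZariskiCharts.charts (X := X))
    {q : X → ℂ} (hq : q ∈ Algebra.adjoin ℂ c.2) : IsOpen[zariski X] (chartLocus c q) :=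
  TopologicalSpace.GenerateOpen.basic _ ⟨c, hc, q, hq, rfl⟩

theorem isOpen_chart {c : Set X × Set (X → ℂ)} (hc : c ∈ ZariskiCharts.charts (X := X)) :
    IsOpen[zariski X] c.1 := by
  have := isOpen_chartLocus hc (one_mem (Algebra.adjoin ℂ c.2))
  convert this using 1
  ext x
  simp [chartLocus]

/-- The loci `chartLocus c q` form a basis of the Zariski topology. -/
theorem exists_chartLocus_subset [DirectedCharts X] {N : Set X} (hN : IsOpen[zariski X] N) {x : X}
    (hx : x ∈ N) : ∃ c ∈ ZariskiCharts.charts (X := X), ∃ q ∈ Algebra.adjoin ℂ c.2,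
      x ∈ c.1 ∧ q x ≠ 0 ∧ chartLocus c q ⊆ N := by
  induction hN with
  | basic s hs =>
    obtain ⟨c, hc, q, hq, rfl⟩ := hs
    exact ⟨c, hc, q, hq, hx.1, hx.2, fun _ h => h⟩
  | univ =>
    obtain ⟨c, hc, hxc⟩ := DirectedCharts.cover x
    exact ⟨c, hc, 1, one_mem _, hxc, by simp, Set.subset_univ _⟩
  | inter s t _ _ ihs iht =>
    obtain ⟨c, hc, q, hq, hxc, hqx, hs⟩ := ihs hx.1
    obtain ⟨d, hd, r, hr, hxd, hrx, ht⟩ := iht hx.2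
    obtain ⟨e, he, hxe, hec, hed, hce, hde⟩ := DirectedCharts.inf c hc d hd x hxc hxd
    obtain ⟨q', hq', eq⟩ := exists_adjoin_eqOn hce hq
    obtain ⟨r', hr', er⟩ := exists_adjoin_eqOn hde hr
    refine ⟨e, he, q' * r', mul_mem hq' hr', hxe, ?_, fun a ha => ?_⟩
    · simpa [← eq hxe, ← er hxe] using ⟨hqx, hrx⟩
    · have h2 : q a ≠ 0 ∧ r a ≠ 0 := by simpa [← eq ha.1, ← er ha.1] using ha.2
      exact ⟨hs ⟨hec ha.1, h2.1⟩, ht ⟨hed ha.1, h2.2⟩⟩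
  | sUnion S _ ih =>
    obtain ⟨s, hs, hxs⟩ := hx
    obtain ⟨c, hc, q, hq, hxc, hqx, h⟩ := ih s hs hxs
    exact ⟨c, hc, q, hq, hxc, hqx, h.trans (Set.subset_sUnion_of_mem hs)⟩

/-- `f`, considered as a function on `S`, is regular near the point `x`. -/
def IsRegularAt (S : Set X) (f : X → ℂ) (x : X) : Prop :=
  ∃ c ∈ ZariskiCharts.charts (X := X), x ∈ c.1 ∧
    ∃ p ∈ Algebra.adjoin ℂ c.2, ∃ q ∈ Algebra.adjoin ℂ c.2, q x ≠ 0 ∧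
      ∀ x' ∈ S ∩ c.1, q x' ≠ 0 → f x' = p x' / q x'

/-- Regularity at a point is local. Multiplying numerator and denominator by a function whose
nonvanishing locus lies in `N` leaves the quotient unchanged and makes nonvanishing of the new
denominator force membership in `N`. -/
theorem IsRegularAt.of_inter [DirectedCharts X] {S N : Set X} {f : X → ℂ} {x : X}
    (hN : IsOpen[zariski X] N) (hx : x ∈ N) (h : IsRegularAt (S ∩ N) f x) : IsRegularAt S f x := by
  obtain ⟨c, hc, hxc, p, hp, q, hq, hqx, H⟩ := h
  obtain ⟨d, hd, r, hr, hxd, hrx, hrN⟩ := exists_chartLocus_subset hN hx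
  obtain ⟨e, he, hxe, hec, hed, hce, hde⟩ := DirectedCharts.inf c hc d hd x hxc hxd
  obtain ⟨p', hp', ep⟩ := exists_adjoin_eqOn hce hp
  obtain ⟨q', hq', eq⟩ := exists_adjoin_eqOn hce hq
  obtain ⟨r', hr', er⟩ := exists_adjoin_eqOn hde hr
  refine ⟨e, he, hxe, p' * r', mul_mem hp' hr', q' * r', mul_mem hq' hr', ?_, fun a ha ha' => ?_⟩
  · simpa [← eq hxe, ← er hxe] using ⟨hqx, hrx⟩
  · have h2 : q a ≠ 0 ∧ r a ≠ 0 := by simpa [← eq ha.2, ← er ha.2] using ha'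
    rw [H a ⟨⟨ha.1, hrN ⟨hed ha.2, h2.2⟩⟩, hec ha.2⟩ h2.1, Pi.mul_apply, Pi.mul_apply, ← ep ha.2,
      ← eq ha.2, ← er ha.2, mul_div_mul_right _ _ h2.2]

theorem IsRegularAt.mono {S S' : Set X} {f : X → ℂ} {x : X} (h : IsRegularAt S f x)
    (hS : S' ⊆ S) : IsRegularAt S' f x := by
  obtain ⟨c, hc, hxc, p, hp, q, hq, hqx, H⟩ := h
  exact ⟨c, hc, hxc, p, hp, q, hq, hqx, fun a ha => H a ⟨hS ha.1, ha.2⟩⟩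

theorem IsRegularAt.congr {S : Set X} {f g : X → ℂ} {x : X} (h : IsRegularAt S f x)
    (hfg : Set.EqOn f g S) : IsRegularAt S g x := by
  obtain ⟨c, hc, hxc, p, hp, q, hq, hqx, H⟩ := h
  exact ⟨c, hc, hxc, p, hp, q, hq, hqx, fun a ha ha' => (hfg ha.1).symm.trans (H a ha ha')⟩

theorem isRegularAt_of_mem_adjoin {S : Set X} {c : Set X × Set (X → ℂ)}
    (hc : c ∈ ZariskiCharts.charts (X := X)) {p : X → ℂ} (hp : p ∈ Algebra.adjoin ℂ c.2) {x : X}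
    (hx : x ∈ c.1) : IsRegularAt S p x :=
  ⟨c, hc, hx, p, hp, 1, one_mem _, by simp, by simp⟩

theorem isRegularAt_of_mem {S : Set X} {c : Set X × Set (X → ℂ)}
    (hc : c ∈ ZariskiCharts.charts (X := X)) {p : X → ℂ} (hp : p ∈ c.2) {x : X}
    (hx : x ∈ c.1) : IsRegularAt S p x :=
  isRegularAt_of_mem_adjoin hc (Algebra.subset_adjoin hp) hx

/-- A common refinement of the two charts allows both fractions to be brought to one denominator;
the closure properties below reduce to arithmetic of fractions. -/
theorem IsRegularAt.exists_common [DirectedCharts X] {S : Set X} {f g : X → ℂ} {x : X}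
    (hf : IsRegularAt S f x) (hg : IsRegularAt S g x) :
    ∃ c ∈ ZariskiCharts.charts (X := X), x ∈ c.1 ∧
      ∃ p ∈ Algebra.adjoin ℂ c.2, ∃ r ∈ Algebra.adjoin ℂ c.2, ∃ q ∈ Algebra.adjoin ℂ c.2,
        q x ≠ 0 ∧ ∀ x' ∈ S ∩ c.1, q x' ≠ 0 → f x' = p x' / q x' ∧ g x' = r x' / q x' := by
  obtain ⟨c, hc, hxc, p, hp, q, hq, hqx, H⟩ := hf
  obtain ⟨d, hd, hxd, r, hr, s, hs, hsx, K⟩ := hg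
  obtain ⟨e, he, hxe, hec, hed, hce, hde⟩ := DirectedCharts.inf c hc d hd x hxc hxd
  obtain ⟨p', hp', ep⟩ := exists_adjoin_eqOn hce hp
  obtain ⟨q', hq', eq⟩ := exists_adjoin_eqOn hce hq
  obtain ⟨r', hr', er⟩ := exists_adjoin_eqOn hde hr
  obtain ⟨s', hs', es⟩ := exists_adjoin_eqOn hde hs
  refine ⟨e, he, hxe, p' * s', mul_mem hp' hs', q' * r', mul_mem hq' hr', q' * s',
    mul_mem hq' hs', ?_, fun a ha ha' => ?_⟩
  · simpa [← eq hxe, ← es hxe] using ⟨hqx, hsx⟩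
  · have h2 : q a ≠ 0 ∧ s a ≠ 0 := by simpa [← eq ha.2, ← es ha.2] using ha'
    rw [H a ⟨ha.1, hec ha.2⟩ h2.1, K a ⟨ha.1, hed ha.2⟩ h2.2]
    simp only [Pi.mul_apply, ← ep ha.2, ← eq ha.2, ← er ha.2, ← es ha.2]
    exact ⟨(mul_div_mul_right _ _ h2.2).symm, (mul_div_mul_left _ _ h2.1).symm⟩

theorem IsRegularAt.add [DirectedCharts X] {S : Set X} {f g : X → ℂ} {x : X}
    (hf : IsRegularAt S f x) (hg : IsRegularAt S g x) : IsRegularAt S (f + g) x := by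
  obtain ⟨c, hc, hxc, p, hp, r, hr, q, hq, hqx, H⟩ := hf.exists_common hg
  refine ⟨c, hc, hxc, p + r, add_mem hp hr, q, hq, hqx, fun a ha ha' => ?_⟩
  rw [Pi.add_apply, (H a ha ha').1, (H a ha ha').2, Pi.add_apply, add_div]

theorem IsRegularAt.mul [DirectedCharts X] {S : Set X} {f g : X → ℂ} {x : X}
    (hf : IsRegularAt S f x) (hg : IsRegularAt S g x) : IsRegularAt S (f * g) x := by
  obtain ⟨c, hc, hxc, p, hp, r, hr, q, hq, hqx, H⟩ := hf.exists_common hg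
  refine ⟨c, hc, hxc, p * r, mul_mem hp hr, q * q, mul_mem hq hq, by simpa using hqx,
    fun a ha ha' => ?_⟩
  have ha'' : q a ≠ 0 := by simpa using ha'
  rw [Pi.mul_apply, (H a ha ha'').1, (H a ha ha'').2, Pi.mul_apply, Pi.mul_apply, div_mul_div_comm]

theorem isRegularAt_const [DirectedCharts X] (S : Set X) (a : ℂ) (x : X) :
    IsRegularAt S (fun _ => a) x := by
  obtain ⟨c, hc, hx⟩ := DirectedCharts.cover x
  exact isRegularAt_of_mem_adjoin hc (Subalgebra.algebraMap_mem _ a) hx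

theorem IsRegularAt.exists_ne_zero {S : Set X} {f : X → ℂ} {x : X} (hxS : x ∈ S)
    (hf : IsRegularAt S f x) (hx : f x ≠ 0) :
    ∃ N, IsOpen[zariski X] N ∧ x ∈ N ∧ ∀ a ∈ S ∩ N, f a ≠ 0 := by
  obtain ⟨c, hc, hxc, p, hp, q, hq, hqx, H⟩ := hf
  rw [H x ⟨hxS, hxc⟩ hqx] at hx
  refine ⟨_, isOpen_chartLocus hc (mul_mem hp hq), ⟨hxc, ?_⟩, fun a ha => ?_⟩
  · simpa using ⟨(div_ne_zero_iff.mp hx).1, hqx⟩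
  · have h2 : p a ≠ 0 ∧ q a ≠ 0 := by simpa using ha.2.2
    rw [H a ⟨ha.1, ha.2.1⟩ h2.2]
    exact div_ne_zero h2.1 h2.2

theorem IsRegularAt.div [DirectedCharts X] {S : Set X} {f g : X → ℂ} {x : X} (hxS : x ∈ S)
    (hf : IsRegularAt S f x) (hg : IsRegularAt S g x) (hx : g x ≠ 0) :
    IsRegularAt S (fun a => f a / g a) x := by
  obtain ⟨c, hc, hxc, p, hp, r, hr, q, hq, hqx, H⟩ := hf.exists_common hg
  rw [(H x ⟨hxS, hxc⟩ hqx).2] at hx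
  refine ⟨c, hc, hxc, p * q, mul_mem hp hq, r * q, mul_mem hr hq, ?_, fun a ha ha' => ?_⟩
  · simpa using ⟨(div_ne_zero_iff.mp hx).1, hqx⟩
  · have h2 : r a ≠ 0 ∧ q a ≠ 0 := by simpa using ha'
    change f a / g a = _
    rw [(H a ha h2.2).1, (H a ha h2.2).2, Pi.mul_apply, Pi.mul_apply, div_div_div_cancel_right₀ h2.2,
      mul_div_mul_right _ _ h2.2]

/-- `φ` is continuous on `S` and pulls the generating functions of charts back to regular
functions. -/
def IsRegularMapOn (φ : X → X') (S : Set X) : Prop :=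
  ∀ x ∈ S, ∀ c ∈ ZariskiCharts.charts (X := X'), φ x ∈ c.1 →
    (∃ N, IsOpen[zariski X] N ∧ x ∈ N ∧ ∀ a ∈ S ∩ N, φ a ∈ c.1) ∧
      ∀ g ∈ c.2, IsRegularAt S (g ∘ φ) x

theorem IsRegularMapOn.mono {φ : X → X'} {S S' : Set X} (h : IsRegularMapOn φ S) (hS : S' ⊆ S) :
    IsRegularMapOn φ S' := fun x hx c hc hφ => by
  obtain ⟨⟨N, hN, hxN, H⟩, K⟩ := h x (hS hx) c hc hφ
  exact ⟨⟨N, hN, hxN, fun a ha => H a ⟨hS ha.1, ha.2⟩⟩, fun g hg => (K g hg).mono hS⟩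

theorem IsRegularMapOn.isRegularAt_adjoin [DirectedCharts X] {φ : X → X'} {S : Set X}
    (h : IsRegularMapOn φ S) {x : X} (hx : x ∈ S) {c : Set X' × Set (X' → ℂ)}
    (hc : c ∈ ZariskiCharts.charts (X := X')) (hφ : φ x ∈ c.1) {p : X' → ℂ}
    (hp : p ∈ Algebra.adjoin ℂ c.2) : IsRegularAt S (p ∘ φ) x := by
  induction hp using Algebra.adjoin_induction with
  | mem g hg => exact (h x hx c hc hφ).2 g hg
  | algebraMap r => exact isRegularAt_const S r x
  | add f g _ _ hf hg => exact hf.add hg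
  | mul f g _ _ hf hg => exact hf.mul hg

theorem IsRegularMapOn.exists_open [DirectedCharts X] {φ : X → X'} {S : Set X}
    (h : IsRegularMapOn φ S) {W : Set X'} (hW : IsOpen[zariski X'] W) {x : X} (hx : x ∈ S)
    (hxW : φ x ∈ W) : ∃ N, IsOpen[zariski X] N ∧ x ∈ N ∧ ∀ a ∈ S ∩ N, φ a ∈ W := by
  induction hW with
  | basic s hs =>
    obtain ⟨c, hc, q, hq, rfl⟩ := hs
    obtain ⟨N, hN, hxN, H⟩ := (h x hx c hc hxW.1).1
    obtain ⟨N', hN', hxN', H'⟩ :=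
      (h.isRegularAt_adjoin hx hc hxW.1 hq).exists_ne_zero hx hxW.2
    exact ⟨N ∩ N', @IsOpen.inter X (zariski X) _ _ hN hN', ⟨hxN, hxN'⟩,
      fun a ha => ⟨H a ⟨ha.1, ha.2.1⟩, H' a ⟨ha.1, ha.2.2⟩⟩⟩
  | univ => exact ⟨Set.univ, @isOpen_univ X (zariski X), trivial, fun _ _ => trivial⟩
  | inter s t _ _ ihs iht =>
    obtain ⟨N, hN, hxN, H⟩ := ihs hxW.1
    obtain ⟨N', hN', hxN', H'⟩ := iht hxW.2
    exact ⟨N ∩ N', @IsOpen.inter X (zariski X) _ _ hN hN', ⟨hxN, hxN'⟩,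
      fun a ha => ⟨H a ⟨ha.1, ha.2.1⟩, H' a ⟨ha.1, ha.2.2⟩⟩⟩
  | sUnion T _ ih =>
    obtain ⟨s, hs, hxs⟩ := hxW
    obtain ⟨N, hN, hxN, H⟩ := ih s hs hxs
    exact ⟨N, hN, hxN, fun a ha => ⟨s, hs, H a ha⟩⟩

/-- Near `x` the map lands in the locus where `f` is given by a single fraction. There the pullback
is a quotient of pullbacks of polynomials in the generators, and locality removes the shrinking. -/
theorem IsRegularMapOn.isRegularAt_comp [DirectedCharts X] {φ : X → X'} {S : Set X}
    {T : Set X'} (h : IsRegularMapOn φ S) {x : X} (hx : x ∈ S) (hST : Set.MapsTo φ S T)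
    {f : X' → ℂ} (hf : IsRegularAt T f (φ x)) : IsRegularAt S (f ∘ φ) x := by
  obtain ⟨c, hc, hxc, p, hp, q, hq, hqx, H⟩ := hf
  obtain ⟨N, hN, hxN, K⟩ := h.exists_open (isOpen_chartLocus hc hq) hx ⟨hxc, hqx⟩
  refine IsRegularAt.of_inter hN hxN ?_
  refine (IsRegularAt.div (Set.mem_inter hx hxN) ((h.isRegularAt_adjoin hx hc hxc hp).mono Set.inter_subset_left)
    ((h.isRegularAt_adjoin hx hc hxc hq).mono Set.inter_subset_left) hqx).congr fun a ha => ?_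
  exact (H (φ a) ⟨hST ha.1, (K a ha).1⟩ (K a ha).2).symm

theorem IsRegularMapOn.comp [DirectedCharts X] {φ : X → X'} {ψ : X' → X''} {S : Set X}
    {T : Set X'} (hψ : IsRegularMapOn ψ T) (hφ : IsRegularMapOn φ S) (hST : Set.MapsTo φ S T) :
    IsRegularMapOn (ψ ∘ φ) S := fun x hx c hc hc' => by
  obtain ⟨⟨N, hN, hxN, H⟩, K⟩ := hψ (φ x) (hST hx) c hc hc'
  obtain ⟨N', hN', hxN', H'⟩ := hφ.exists_open hN hx hxN
  exact ⟨⟨N', hN', hxN', fun a ha => H _ ⟨hST ha.1, H' a ha⟩⟩,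
    fun g hg => hφ.isRegularAt_comp hx hST (K g hg)⟩

/-- This reduces every later morphism claim to generators of charts. -/
theorem IsRegularMapOn.isMorphismOn [DirectedCharts X] {φ : X → X'} {S : Set X} {T : Set X'}
    (h : IsRegularMapOn φ S) (hST : Set.MapsTo φ S T) : IsMorphismOn φ S T where
  mapsTo := hST
  continuousOn W hW := by
    refine ⟨⋃₀ {N | IsOpen[zariski X] N ∧ ∀ a ∈ S ∩ N, φ a ∈ W},
      @isOpen_sUnion X (zariski X) _ fun N hN => hN.1, Set.Subset.antisymm ?_ ?_⟩
    · rintro x ⟨hx, hxW⟩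
      obtain ⟨N, hN, hxN, H⟩ := h.exists_open hW hx hxW
      exact ⟨hx, N, ⟨hN, H⟩, hxN⟩
    · rintro x ⟨hx, N, ⟨_, H⟩, hxN⟩
      exact ⟨hx, H x ⟨hx, hxN⟩⟩
  isRegularOn W _ f hf x hx :=
    (h.mono Set.inter_subset_left).isRegularAt_comp hx (T := T ∩ W)
      (fun a ha => ⟨hST ha.1, ha.2⟩) (hf (φ x) ⟨hST hx.1, hx.2⟩)

end Zariski

/-! ### Affine spaces and products -/

instance (ι : Type) : DirectedCharts (ι → ℂ) where
  cover x := ⟨_, rfl, trivial⟩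
  inf := by
    rintro c rfl d rfl x - -
    exact ⟨_, rfl, trivial, subset_rfl, subset_rfl,
      fun g hg => ⟨g, Algebra.subset_adjoin hg, fun _ _ => rfl⟩,
      fun g hg => ⟨g, Algebra.subset_adjoin hg, fun _ _ => rfl⟩⟩

theorem exists_adjoin_prod {X X' : Type} {a : Set X × Set (X → ℂ)} {b : Set X' × Set (X' → ℂ)}
    {G : Set (X × X' → ℂ)}
    (hG : G = {f | ∃ g ∈ a.2, f = fun x : X × X' => g x.1} ∪
      {f | ∃ g ∈ b.2, f = fun x : X × X' => g x.2}) :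
    (∀ p ∈ Algebra.adjoin ℂ a.2, (fun x : X × X' => p x.1) ∈ Algebra.adjoin ℂ G) ∧
    (∀ p ∈ Algebra.adjoin ℂ b.2, (fun x : X × X' => p x.2) ∈ Algebra.adjoin ℂ G) := by
  subst hG
  constructor
  · intro p hp
    induction hp using Algebra.adjoin_induction with
    | mem g hg => exact Algebra.subset_adjoin (Or.inl ⟨g, hg, rfl⟩)
    | algebraMap r => exact Subalgebra.algebraMap_mem _ r
    | add f g _ _ hf hg => exact add_mem hf hg
    | mul f g _ _ hf hg => exact mul_mem hf hg
  · intro p hp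
    induction hp using Algebra.adjoin_induction with
    | mem g hg => exact Algebra.subset_adjoin (Or.inr ⟨g, hg, rfl⟩)
    | algebraMap r => exact Subalgebra.algebraMap_mem _ r
    | add f g _ _ hf hg => exact add_mem hf hg
    | mul f g _ _ hf hg => exact mul_mem hf hg

section Prod

variable {X X' X'' : Type} [ZariskiCharts X] [ZariskiCharts X'] [ZariskiCharts X'']

instance [DirectedCharts X] [DirectedCharts X'] : DirectedCharts (X × X') where
  cover x := by
    obtain ⟨a, ha, hxa⟩ := DirectedCharts.cover x.1
    obtain ⟨b, hb, hxb⟩ := DirectedCharts.cover x.2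
    exact ⟨_, ⟨a, ha, b, hb, rfl⟩, hxa, hxb⟩
  inf := by
    rintro _ ⟨a, ha, b, hb, rfl⟩ _ ⟨a', ha', b', hb', rfl⟩ x ⟨h1, h2⟩ ⟨h3, h4⟩
    obtain ⟨e, he, hxe, hea, hea', hae, hae'⟩ := DirectedCharts.inf a ha a' ha' x.1 h1 h3
    obtain ⟨f, hf, hxf, hfb, hfb', hbf, hbf'⟩ := DirectedCharts.inf b hb b' hb' x.2 h2 h4
    obtain ⟨A, B⟩ := exists_adjoin_prod (a := e) (b := f) rfl
    refine ⟨_, ⟨e, he, f, hf, rfl⟩, ⟨hxe, hxf⟩, Set.prod_mono hea hfb, Set.prod_mono hea' hfb',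
      ?_, ?_⟩
    · rintro _ (⟨g, hg, rfl⟩ | ⟨g, hg, rfl⟩)
      · obtain ⟨g', hg', E⟩ := hae g hg
        exact ⟨_, A g' hg', fun y hy => E hy.1⟩
      · obtain ⟨g', hg', E⟩ := hbf g hg
        exact ⟨_, B g' hg', fun y hy => E hy.2⟩
    · rintro _ (⟨g, hg, rfl⟩ | ⟨g, hg, rfl⟩)
      · obtain ⟨g', hg', E⟩ := hae' g hg
        exact ⟨_, A g' hg', fun y hy => E hy.1⟩
      · obtain ⟨g', hg', E⟩ := hbf' g hg
        exact ⟨_, B g' hg', fun y hy => E hy.2⟩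

theorem isRegularMapOn_pi {ι : Type} {φ : X → ι → ℂ} {S : Set X}
    (h : ∀ x ∈ S, ∀ i, IsRegularAt S (fun a => φ a i) x) : IsRegularMapOn φ S := by
  rintro x hx _ rfl -
  refine ⟨⟨Set.univ, @isOpen_univ X (zariski X), trivial, fun _ _ => trivial⟩, ?_⟩
  rintro _ ⟨i, rfl⟩
  exact h x hx i

theorem isRegularAt_apply {ι : Type} (S : Set (ι → ℂ)) (i : ι) (x : ι → ℂ) :
    IsRegularAt S (fun a => a i) x :=
  isRegularAt_of_mem (X := ι → ℂ) (c := (Set.univ, {f | ∃ i, f = fun x => x i})) rfl ⟨i, rfl⟩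
    trivial

theorem IsRegularMapOn.prodMk {φ : X → X'} {ψ : X → X''} {S : Set X}
    (hφ : IsRegularMapOn φ S) (hψ : IsRegularMapOn ψ S) :
    IsRegularMapOn (fun x => (φ x, ψ x)) S := by
  rintro x hx _ ⟨a, ha, b, hb, rfl⟩ ⟨h1, h2⟩
  obtain ⟨⟨N, hN, hxN, H⟩, K⟩ := hφ x hx a ha h1
  obtain ⟨⟨N', hN', hxN', H'⟩, K'⟩ := hψ x hx b hb h2
  refine ⟨⟨N ∩ N', @IsOpen.inter X (zariski X) _ _ hN hN', ⟨hxN, hxN'⟩,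
      fun a ha => ⟨H a ⟨ha.1, ha.2.1⟩, H' a ⟨ha.1, ha.2.2⟩⟩⟩, ?_⟩
  rintro _ (⟨g, hg, rfl⟩ | ⟨g, hg, rfl⟩)
  · exact K g hg
  · exact K' g hg

theorem isRegularMapOn_fst [DirectedCharts X'] (S : Set (X × X')) :
    IsRegularMapOn Prod.fst S := by
  intro x _ a ha hxa
  obtain ⟨b, hb, hxb⟩ := DirectedCharts.cover x.2
  have hc : (a.1 ×ˢ b.1, _) ∈ ZariskiCharts.charts (X := X × X') := ⟨a, ha, b, hb, rfl⟩
  exact ⟨⟨_, isOpen_chart hc, ⟨hxa, hxb⟩, fun y hy => hy.2.1⟩,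
    fun g hg => isRegularAt_of_mem hc (Or.inl ⟨g, hg, rfl⟩) ⟨hxa, hxb⟩⟩

theorem isRegularMapOn_snd [DirectedCharts X] (S : Set (X × X')) :
    IsRegularMapOn Prod.snd S := by
  intro x _ b hb hxb
  obtain ⟨a, ha, hxa⟩ := DirectedCharts.cover x.1
  have hc : (a.1 ×ˢ b.1, _) ∈ ZariskiCharts.charts (X := X × X') := ⟨a, ha, b, hb, rfl⟩
  exact ⟨⟨_, isOpen_chart hc, ⟨hxa, hxb⟩, fun y hy => hy.2.2⟩,
    fun g hg => isRegularAt_of_mem hc (Or.inr ⟨g, hg, rfl⟩) ⟨hxa, hxb⟩⟩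

end Prod

/-! ### Points over affine open subsets -/

theorem exists_isAffineOpen {Y : Scheme.{0}} (U : Y.Opens) {y : Y} (hy : y ∈ U) :
    ∃ V : Y.Opens, IsAffineOpen V ∧ y ∈ V ∧ V ≤ U := by
  obtain ⟨V, hV, hxV, hVU⟩ := Y.isBasis_affineOpens.exists_subset_of_mem_open
    (show y ∈ (U : Set Y) from hy) U.2
  obtain ⟨V, hVaff, rfl⟩ := hV
  exact ⟨V, hVaff, hxV, hVU⟩

theorem germ_comp_stalkClosedPointTo {Y : Scheme.{0}} {R : Type} [CommRing R] [IsLocalRing R]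
    (f : Spec (.of R) ⟶ Y) (U : Y.Opens) (hU : f (IsLocalRing.closedPoint R) ∈ U) :
    Y.presheaf.germ U _ hU ≫ Scheme.stalkClosedPointTo f =
      f.appLE U ⊤ (Scheme.preimage_eq_top_of_closedPoint_mem f hU).ge ≫
      (Scheme.ΓSpecIso (.of R)).hom := by
  rw [Scheme.germ_stalkClosedPointTo f U hU, Scheme.Hom.appLE, Category.assoc]
  rfl

section

variable {Y : Scheme.{0}} [Y.Over (Spec (.of ℂ))]

variable (Y) in
/-- The structure map `ℂ → Γ(Y, V)`. -/
noncomputable def scalars (V : Y.Opens) : ℂ →+* Γ(Y, V) :=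
  ((Scheme.ΓSpecIso (.of ℂ)).inv ≫ (Y ↘ Spec (.of ℂ)).appLE ⊤ V le_top).hom

/-- Replaces the pullback through the stalk by a map on sections, for which composition of morphisms
is easy to track. -/
theorem Points.pull_eq_appLE {R : Type} [CommRing R] [IsLocalRing R] [Algebra ℂ R]
    (γ : Points Y R) (U : Y.Opens) (hU : γ.base ∈ U) :
    γ.pull U hU = (γ.1.appLE U ⊤ (Scheme.preimage_eq_top_of_closedPoint_mem γ.1 hU).ge ≫
      (Scheme.ΓSpecIso (.of R)).hom).hom :=
  congrArg CommRingCat.Hom.hom (germ_comp_stalkClosedPointTo γ.1 U hU)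

theorem Points.base_map {R R' : Type} [CommRing R] [IsLocalRing R] [Algebra ℂ R] [CommRing R']
    [IsLocalRing R'] [Algebra ℂ R'] (φ : R →ₐ[ℂ] R') [IsLocalHom φ.toRingHom] (γ : Points Y R) :
    (γ.map φ).base = γ.base := by
  have : IsLocalHom (CommRingCat.ofHom φ.toRingHom).hom := ‹_›
  exact congrArg γ.1 (Spec_closedPoint (f := CommRingCat.ofHom φ.toRingHom))

theorem specMap_appLE_top {R R' : Type} [CommRing R] [CommRing R'] (φ : R →+* R') :
    (Spec.map (CommRingCat.ofHom φ)).appLE ⊤ ⊤ le_rfl ≫ (Scheme.ΓSpecIso (.of R')).hom =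
      (Scheme.ΓSpecIso (.of R)).hom ≫ CommRingCat.ofHom φ := by
  rw [← Scheme.ΓSpecIso_naturality, Scheme.Hom.appTop, Scheme.Hom.app_eq_appLE]
  rfl

theorem Points.pull_map_apply {R R' : Type} [CommRing R] [IsLocalRing R] [Algebra ℂ R] [CommRing R']
    [IsLocalRing R'] [Algebra ℂ R'] (φ : R →ₐ[ℂ] R') (γ : Points Y R)
    (U : Y.Opens) (hU : γ.base ∈ U) (hU' : (γ.map φ).base ∈ U) (f : Γ(Y, U)) :
    (γ.map φ).pull U hU' f = φ (γ.pull U hU f) := by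
  rw [Points.pull_eq_appLE, Points.pull_eq_appLE]
  have h : (γ.map φ).1.appLE U ⊤ (Scheme.preimage_eq_top_of_closedPoint_mem _ hU').ge =
      γ.1.appLE U ⊤ (Scheme.preimage_eq_top_of_closedPoint_mem γ.1 hU).ge ≫
        (Spec.map (CommRingCat.ofHom φ.toRingHom)).appLE ⊤ ⊤ le_rfl :=
    (Scheme.Hom.appLE_comp_appLE _ _ _ _ _ _ _).symm
  rw [h, Category.assoc, specMap_appLE_top]
  rfl

theorem scalars_comp_appLE {R : Type} [CommRing R] (φ : ℂ →+* R) (f : Spec (.of R) ⟶ Y)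
    (hf : f ≫ (Y ↘ Spec (.of ℂ)) = Spec.map (CommRingCat.ofHom φ)) (U : Y.Opens)
    (hU : ⊤ ≤ f ⁻¹ᵁ U) :
    CommRingCat.ofHom (scalars Y U) ≫ f.appLE U ⊤ hU ≫ (Scheme.ΓSpecIso (.of R)).hom =
      CommRingCat.ofHom φ := by
  have h := Scheme.Hom.appLE_comp_appLE f (Y ↘ Spec (.of ℂ)) ⊤ U ⊤ le_top hU
  simp only [hf] at h
  rw [scalars, CommRingCat.ofHom_hom, Category.assoc, reassoc_of% h, specMap_appLE_top,
    Iso.inv_hom_id_assoc]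

theorem Points.pull_scalars {R : Type} [CommRing R] [IsLocalRing R] [Algebra ℂ R]
    (γ : Points Y R) (U : Y.Opens) (hU : γ.base ∈ U) (a : ℂ) :
    γ.pull U hU (scalars Y U a) = algebraMap ℂ R a := by
  rw [Points.pull_eq_appLE]
  exact congrArg (fun f => f.hom a) (scalars_comp_appLE (algebraMap ℂ R) γ.1 γ.2 U
    (Scheme.preimage_eq_top_of_closedPoint_mem γ.1 hU).ge)

/-- An open subset of the spectrum of a local ring that contains the closed point is everything, so
a point based in an affine `V` factors through `V` and is determined by a ring homomorphism out of
`Γ(Y, V)`. -/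
theorem Points.spec_map_pull {R : Type} [CommRing R] [IsLocalRing R] [Algebra ℂ R]
    (γ : Points Y R) {V : Y.Opens} (hV : IsAffineOpen V) (h : γ.base ∈ V) :
    Spec.map (CommRingCat.ofHom (γ.pull V h)) ≫ hV.fromSpec = γ.1 := by
  have := IsAffineOpen.SpecMap_appLE_fromSpec γ.1 hV (isAffineOpen_top _)
    (Scheme.preimage_eq_top_of_closedPoint_mem γ.1 h).ge
  rw [IsAffineOpen.fromSpec_top, Iso.eq_inv_comp, Scheme.isoSpec_Spec_hom] at this
  rw [Points.pull_eq_appLE, CommRingCat.ofHom_hom, Spec.map_comp, Category.assoc]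
  exact this

theorem Points.ext_of_pull {R : Type} [CommRing R] [IsLocalRing R] [Algebra ℂ R]
    {γ γ' : Points Y R} {V : Y.Opens} (hV : IsAffineOpen V) (h : γ.base ∈ V) (h' : γ'.base ∈ V)
    (e : γ.pull V h = γ'.pull V h') : γ = γ' :=
  Subtype.ext (by rw [← γ.spec_map_pull hV h, ← γ'.spec_map_pull hV h', e])

theorem fromSpec_over {V : Y.Opens} (hV : IsAffineOpen V) :
    hV.fromSpec ≫ (Y ↘ Spec (.of ℂ)) = Spec.map (CommRingCat.ofHom (scalars Y V)) := by
  have := IsAffineOpen.SpecMap_appLE_fromSpec (Y ↘ Spec (.of ℂ)) (isAffineOpen_top _) hV le_top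
  rw [IsAffineOpen.fromSpec_top, Scheme.isoSpec_Spec_inv] at this
  rw [scalars, CommRingCat.ofHom_hom, Spec.map_comp]
  exact this.symm

/-- The point of the affine open subset `V` given by a homomorphism on functions. -/
noncomputable def Points.ofHom {R : Type} [CommRing R] [Algebra ℂ R] {V : Y.Opens}
    (hV : IsAffineOpen V) (a : Γ(Y, V) →+* R) (ha : a.comp (scalars Y V) = algebraMap ℂ R) :
    Points Y R :=
  ⟨Spec.map (CommRingCat.ofHom a) ≫ hV.fromSpec, by
    rw [Category.assoc, fromSpec_over, ← Spec.map_comp, ← CommRingCat.ofHom_comp, ha]⟩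

theorem Points.base_ofHom {R : Type} [CommRing R] [IsLocalRing R] [Algebra ℂ R] {V : Y.Opens}
    (hV : IsAffineOpen V) (a : Γ(Y, V) →+* R) (ha : a.comp (scalars Y V) = algebraMap ℂ R) :
    (Points.ofHom hV a ha).base ∈ V := by
  have h := hV.range_fromSpec
  change _ ∈ (V : Set Y)
  rw [← h]
  exact ⟨_, rfl⟩

theorem Points.pull_ofHom {R : Type} [CommRing R] [IsLocalRing R] [Algebra ℂ R] {V : Y.Opens}
    (hV : IsAffineOpen V) (a : Γ(Y, V) →+* R) (ha : a.comp (scalars Y V) = algebraMap ℂ R)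
    (h : (Points.ofHom hV a ha).base ∈ V) : (Points.ofHom hV a ha).pull V h = a := by
  have h1 := (Points.ofHom hV a ha).spec_map_pull hV h
  have h2 := (cancel_mono hV.fromSpec).mp
    (h1 : _ = Spec.map (CommRingCat.ofHom a) ≫ hV.fromSpec)
  exact congrArg CommRingCat.Hom.hom (Spec.map_injective h2)

/-- The map from the stalk to `ℂ` is local, so the value is a unit, that is nonzero, exactly when
the germ is a unit. -/
theorem Points.pull_eq_zero_iff (y : CPoint Y) (U : Y.Opens) (hU : y.base ∈ U) (f : Γ(Y, U)) :
    y.pull U hU f = 0 ↔ y.base ∉ Y.basicOpen f := by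
  have h1 : y.base ∈ Y.basicOpen f ↔ IsUnit (Y.presheaf.germ U y.base hU f) :=
    Scheme.mem_basicOpen _ _ _ hU
  have h2 : IsUnit (y.pull U hU f) ↔ IsUnit (Y.presheaf.germ U y.base hU f) :=
    isUnit_map_iff (Scheme.stalkClosedPointTo y.1).hom _
  rw [h1, ← h2, isUnit_iff_ne_zero, not_not]

/-! ### Points and jets as varieties -/

theorem evalFun_of_mem {U : Y.Opens} {y : CPoint Y} (h : y.base ∈ U) (f : Γ(Y, U)) :
    evalFun U f y = y.pull U h f := dif_pos h

theorem coeffFun_of_mem {k : ℕ} {U : Y.Opens} {γ : Jet Y k} (h : γ.base ∈ U) (f : Γ(Y, U)) {i : ℕ}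
    (hi : i ≤ k) : coeffFun U f i hi γ = jetCoeff k i hi (γ.pull U h f) := dif_pos h

theorem evalFun_res {U V : Y.Opens} (hVU : V ≤ U) (f : Γ(Y, U)) {y : CPoint Y} (h : y.base ∈ V) :
    evalFun V ((Y.presheaf.map (homOfLE hVU).op).hom f) y = evalFun U f y := by
  rw [evalFun_of_mem h, evalFun_of_mem (hVU h), y.pull_map hVU]

theorem coeffFun_res {k : ℕ} {U V : Y.Opens} (hVU : V ≤ U) (f : Γ(Y, U)) {i : ℕ} (hi : i ≤ k)
    {γ : Jet Y k} (h : γ.base ∈ V) :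
    coeffFun V ((Y.presheaf.map (homOfLE hVU).op).hom f) i hi γ = coeffFun U f i hi γ := by
  rw [coeffFun_of_mem h, coeffFun_of_mem (hVU h), γ.pull_map hVU]

variable (Y) in
theorem mem_pointCharts (U : Y.Opens) : ({y : CPoint Y | y.base ∈ U},
    {φ : CPoint Y → ℂ | ∃ f : Γ(Y, U), φ = evalFun U f}) ∈
      ZariskiCharts.charts (X := CPoint Y) := ⟨U, rfl⟩

variable (Y) in
theorem mem_jetCharts (k : ℕ) (U : Y.Opens) : ({γ : Jet Y k | γ.base ∈ U},
    {φ : Jet Y k → ℂ | ∃ (f : Γ(Y, U)) (i : ℕ) (hi : i ≤ k), φ = coeffFun U f i hi}) ∈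
      ZariskiCharts.charts (X := Jet Y k) := ⟨U, rfl⟩

instance : DirectedCharts (CPoint Y) where
  cover _ := ⟨_, mem_pointCharts Y ⊤, trivial⟩
  inf := by
    rintro _ ⟨U, rfl⟩ _ ⟨V, rfl⟩ y hU hV
    refine ⟨_, mem_pointCharts Y (U ⊓ V), ⟨hU, hV⟩, fun _ h => h.1, fun _ h => h.2, ?_, ?_⟩
    · rintro _ ⟨f, rfl⟩
      exact ⟨_, Algebra.subset_adjoin ⟨_, rfl⟩, fun y hy => (evalFun_res inf_le_left f hy).symm⟩
    · rintro _ ⟨f, rfl⟩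
      exact ⟨_, Algebra.subset_adjoin ⟨_, rfl⟩, fun y hy => (evalFun_res inf_le_right f hy).symm⟩

instance (k : ℕ) : DirectedCharts (Jet Y k) where
  cover _ := ⟨_, mem_jetCharts Y k ⊤, trivial⟩
  inf := by
    rintro _ ⟨U, rfl⟩ _ ⟨V, rfl⟩ y hU hV
    refine ⟨_, mem_jetCharts Y k (U ⊓ V), ⟨hU, hV⟩, fun _ h => h.1, fun _ h => h.2, ?_, ?_⟩
    · rintro _ ⟨f, i, hi, rfl⟩
      exact ⟨_, Algebra.subset_adjoin ⟨_, i, hi, rfl⟩,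
        fun y hy => (coeffFun_res inf_le_left f hi hy).symm⟩
    · rintro _ ⟨f, i, hi, rfl⟩
      exact ⟨_, Algebra.subset_adjoin ⟨_, i, hi, rfl⟩,
        fun y hy => (coeffFun_res inf_le_right f hi hy).symm⟩

instance {k : ℕ} : IsLocalHom (Ideal.Quotient.mkₐ ℂ
    (Ideal.span {(PowerSeries.X : ℂ⟦X⟧) ^ (k + 1)})).toRingHom :=
  IsLocalHom.of_surjective _ Ideal.Quotient.mk_surjective

theorem base_truncArc (k : ℕ) (γ : Arc Y) : (truncArc k γ).base = γ.base :=
  Points.base_map _ γ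

theorem pull_truncArc (k : ℕ) (γ : Arc Y) (U : Y.Opens) (hU : γ.base ∈ U)
    (hU' : (truncArc k γ).base ∈ U) (f : Γ(Y, U)) :
    (truncArc k γ).pull U hU' f = Ideal.Quotient.mk _ (γ.pull U hU f) :=
  Points.pull_map_apply _ γ U hU hU' f

instance {k : ℕ} : IsLocalHom (jetAugmentation k).toRingHom :=
  IsLocalHom.of_surjective _ fun a =>
    ⟨algebraMap ℂ _ a, (jetAugmentation k).commutes a⟩

theorem Jet.base_point {k : ℕ} (γ : Jet Y k) : γ.point.base = γ.base :=
  Points.base_map _ γ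

theorem jetAugmentation_eq {k : ℕ} (x : JetRing k) :
    jetAugmentation k x = jetCoeff k 0 (Nat.zero_le k) x := by
  obtain ⟨f, rfl⟩ := Ideal.Quotient.mk_surjective x
  exact (PowerSeries.coeff_zero_eq_constantCoeff_apply f).symm

theorem evalFun_point {k : ℕ} (U : Y.Opens) (f : Γ(Y, U)) (γ : Jet Y k) :
    evalFun U f γ.point = coeffFun U f 0 (Nat.zero_le k) γ := by
  by_cases h : γ.base ∈ U
  · have h' : γ.point.base ∈ U := γ.base_point ▸ h
    rw [evalFun_of_mem h', coeffFun_of_mem h, ← jetAugmentation_eq]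
    exact Points.pull_map_apply _ γ U h h' f
  · have h' : γ.point.base ∉ U := γ.base_point ▸ h
    rw [evalFun, coeffFun, dif_neg h, dif_neg h']

theorem isRegularMapOn_point {k : ℕ} (S : Set (Jet Y k)) :
    IsRegularMapOn (fun γ : Jet Y k => γ.point) S := by
  rintro γ _ _ ⟨U, rfl⟩ hU
  have hU' : γ.base ∈ U := γ.base_point ▸ hU
  refine ⟨⟨_, isOpen_chart (mem_jetCharts Y k U), hU', fun δ hδ => ?_⟩, ?_⟩
  · exact (δ.base_point ▸ hδ.2 : δ.point.base ∈ U)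
  · rintro _ ⟨f, rfl⟩
    refine (isRegularAt_of_mem (mem_jetCharts Y k U) ⟨f, 0, Nat.zero_le k, rfl⟩ hU').congr ?_
    exact fun δ _ => (evalFun_point U f δ).symm

end

/-! ### Infinitesimal lifting along étale ring homomorphisms -/

/-- Étale implies formally smooth. The square is phrased with bare ring homomorphisms because the
algebra structures vary from one application to the next. -/
theorem exists_lift_of_etale {P A B C : Type} [CommRing P] [CommRing A] [CommRing B] [CommRing C]
    {f : P →+* A} (hf : f.Etale) (u : P →+* B) (v : A →+* C) {g : B →+* C}
    (hg : Function.Surjective g) (hker : IsNilpotent (RingHom.ker g)) (h : g.comp u = v.comp f) :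
    ∃ w : A →+* B, w.comp f = u ∧ g.comp w = v := by
  algebraize [f, u, g.comp u]
  let g' : B →ₐ[P] C := { g with commutes' := fun _ => rfl }
  let v' : A →ₐ[P] C := { v with commutes' := fun x => (congrArg (fun k => k x) h).symm }
  refine ⟨(Algebra.FormallySmooth.liftOfSurjective v' g' hg hker).toRingHom, ?_, ?_⟩
  · exact AlgHom.comp_algebraMap _
  · ext x
    exact Algebra.FormallySmooth.liftOfSurjective_apply v' g' hg hker x

/-- Étale implies formally unramified, hence lifts along a nilpotent kernel are unique. -/
theorem eq_of_etale {P A B C : Type} [CommRing P] [CommRing A] [CommRing B] [CommRing C]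
    {f : P →+* A} (hf : f.Etale) {g : B →+* C} (hker : IsNilpotent (RingHom.ker g))
    {w w' : A →+* B} (h : w.comp f = w'.comp f) (h' : g.comp w = g.comp w') : w = w' := by
  algebraize [f, w.comp f]
  let w₁ : A →ₐ[P] B := { w with commutes' := fun _ => rfl }
  let w₂ : A →ₐ[P] B := { w' with commutes' := fun x => (congrArg (fun k => k x) h).symm }
  have : w₁ = w₂ := Algebra.FormallyUnramified.lift_unique_of_ringHom g hker w₁ w₂ h'
  exact congrArg AlgHom.toRingHom this

/-! ### Truncated power series -/

/-- The ring `R[z]/(z^(t+1))`. -/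
abbrev Trunc (R : Type) [CommRing R] (t : ℕ) : Type :=
  R⟦X⟧ ⧸ Ideal.span {(PowerSeries.X : R⟦X⟧) ^ (t + 1)}

/-- The augmentation of `R[z]/(z^(t+1))`. -/
noncomputable def truncAugmentation (R : Type) [CommRing R] (t : ℕ) : Trunc R t →+* R :=
  Ideal.Quotient.lift _ (PowerSeries.constantCoeff (R := R)) (by
    intro f hf
    rw [Ideal.mem_span_singleton, PowerSeries.X_pow_dvd_iff] at hf
    simpa using hf 0 (Nat.succ_pos t))

theorem truncAugmentation_surjective (R : Type) [CommRing R] (t : ℕ) :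
    Function.Surjective (truncAugmentation R t) := fun a =>
  ⟨Ideal.Quotient.mk _ (PowerSeries.C a), PowerSeries.constantCoeff_C a⟩

/-- The kernel lies in the ideal generated by the class of `X`, whose power `t + 1` is zero. -/
theorem isNilpotent_ker_truncAugmentation (R : Type) [CommRing R] (t : ℕ) :
    IsNilpotent (RingHom.ker (truncAugmentation R t)) := by
  refine ⟨t + 1, le_bot_iff.mp ?_⟩
  have h : RingHom.ker (truncAugmentation R t) ≤
      Ideal.span {Ideal.Quotient.mk _ (PowerSeries.X : R⟦X⟧)} := by
    intro x hx
    obtain ⟨f, rfl⟩ := Ideal.Quotient.mk_surjective x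
    have hx' : PowerSeries.constantCoeff f = 0 := hx
    obtain ⟨g, rfl⟩ := PowerSeries.X_dvd_iff.mpr hx'
    rw [map_mul]
    exact Ideal.mul_mem_right _ _ (Ideal.mem_span_singleton_self _)
  refine (Ideal.pow_right_mono h _).trans ?_
  rw [Ideal.span_singleton_pow, ← map_pow, Ideal.Quotient.eq_zero_iff_mem.mpr
    (Ideal.mem_span_singleton_self _), Ideal.span_singleton_le_iff_mem]
  exact Submodule.zero_mem _

/-- Functoriality of `R[z]/(z^(t+1))` in `R`. -/
noncomputable def truncMap {R R' : Type} [CommRing R] [CommRing R'] (t : ℕ) (e : R →+* R') :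
    Trunc R t →+* Trunc R' t :=
  Ideal.quotientMap _ (PowerSeries.map e) (by
    rw [Ideal.span_singleton_le_iff_mem, Ideal.mem_comap, map_pow, PowerSeries.map_X]
    exact Ideal.mem_span_singleton_self _)

theorem jetCoeff_mk {t i : ℕ} (hi : i ≤ t) (f : ℂ⟦X⟧) :
    jetCoeff t i hi (Ideal.Quotient.mk _ f) = PowerSeries.coeff i f := rfl

theorem truncMap_mk {R R' : Type} [CommRing R] [CommRing R'] (t : ℕ) (e : R →+* R') (f : R⟦X⟧) :
    truncMap t e (Ideal.Quotient.mk _ f) = Ideal.Quotient.mk _ (PowerSeries.map e f) := rfl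

theorem jetAugmentation_eq_trunc (t : ℕ) (x : JetRing t) :
    jetAugmentation t x = truncAugmentation ℂ t x := rfl

theorem truncAugmentation_truncMap {R R' : Type} [CommRing R] [CommRing R'] (t : ℕ) (e : R →+* R')
    (x : Trunc R t) : truncAugmentation R' t (truncMap t e x) = e (truncAugmentation R t x) := by
  obtain ⟨f, rfl⟩ := Ideal.Quotient.mk_surjective x
  rw [truncMap_mk]
  change PowerSeries.constantCoeff (PowerSeries.map e f) = e (PowerSeries.constantCoeff f)
  rw [← PowerSeries.coeff_zero_eq_constantCoeff_apply, PowerSeries.coeff_map,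
    PowerSeries.coeff_zero_eq_constantCoeff_apply]

/-- For `m ≤ t + 1` the element `X ^ (t + 1)` killed by the quotient is itself divisible by `X ^ m`,
so truncation loses no information about this divisibility. -/
theorem X_pow_dvd_mk_iff {t m : ℕ} (hm : m ≤ t + 1) (f : ℂ⟦X⟧) :
    (Ideal.Quotient.mk (Ideal.span {(PowerSeries.X : ℂ⟦X⟧) ^ (t + 1)}) PowerSeries.X ^ m ∣
      Ideal.Quotient.mk (Ideal.span {(PowerSeries.X : ℂ⟦X⟧) ^ (t + 1)}) f) ↔
      PowerSeries.X ^ m ∣ f := by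
  constructor
  · rintro ⟨x, hx⟩
    obtain ⟨g, rfl⟩ := Ideal.Quotient.mk_surjective x
    rw [← map_pow, ← map_mul, Ideal.Quotient.eq, Ideal.mem_span_singleton] at hx
    exact (dvd_sub_left (dvd_mul_right _ _)).mp ((pow_dvd_pow _ hm).trans hx)
  · rintro h
    rw [← map_pow]
    exact map_dvd _ h

theorem jetRing_ext {t : ℕ} {x y : JetRing t}
    (h : ∀ (i : ℕ) (hi : i ≤ t), jetCoeff t i hi x = jetCoeff t i hi y) : x = y := by
  obtain ⟨f, rfl⟩ := Ideal.Quotient.mk_surjective x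
  obtain ⟨g, rfl⟩ := Ideal.Quotient.mk_surjective y
  rw [Ideal.Quotient.eq, Ideal.mem_span_singleton, PowerSeries.X_pow_dvd_iff]
  intro i hi
  rw [map_sub, sub_eq_zero]
  exact h i (Nat.lt_succ_iff.mp hi)

/-! ### Coordinate systems -/

theorem topIso_inv_comp_appTop {Y : Scheme.{0}} {U V : Y.Opens} (hV : IsAffineOpen V)
    (hVU : V ≤ U) (g : Spec Γ(Y, V) ⟶ U) (hg : g ≫ U.ι = hV.fromSpec) :
    U.topIso.inv ≫ g.appTop =
      Y.presheaf.map (homOfLE hVU).op ≫ (Scheme.ΓSpecIso Γ(Y, V)).inv := by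
  have e1 : U.topIso.inv = U.ι.appLE U ⊤ (by simp) := by
    rw [Scheme.Opens.topIso_inv, Scheme.Opens.ι_appLE]
    rfl
  have e2 : g.appTop = g.appLE ⊤ ⊤ le_rfl := by
    rw [Scheme.Hom.appTop, Scheme.Hom.app_eq_appLE]
    rfl
  have e3 : U.ι.appLE U ⊤ (by simp) ≫ g.appLE ⊤ ⊤ le_rfl = hV.fromSpec.appLE U ⊤
      (by rw [← hg]; exact fun x _ => (g x).2) := by
    simp only [← hg]
    exact Scheme.Hom.appLE_comp_appLE _ _ _ _ _ _ _
  refine ((congrArg₂ (· ≫ ·) e1 e2).trans e3).trans ?_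
  rw [Scheme.Hom.appLE, hV.fromSpec_app_of_le U hVU, Category.assoc, Category.assoc,
    ← Functor.map_comp]
  congr 1

section

variable {Y : Scheme.{0}} [Y.Over (Spec (.of ℂ))] {n : ℕ}

/-- The homomorphism `ℂ[x_1, …, x_n] → Γ(Y, V)` given by the restrictions to `V` of functions
`z_1, …, z_n` on `U`. -/
noncomputable def coordHom {U V : Y.Opens} (hVU : V ≤ U) (z : Fin n → Γ(Y, U)) :
    MvPolynomial (Fin n) ℂ →+* Γ(Y, V) :=
  MvPolynomial.eval₂Hom (scalars Y V) fun i => (Y.presheaf.map (homOfLE hVU).op).hom (z i)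

/-- Up to the isomorphism of affine space with the spectrum of the polynomial ring, `Spec` of this
homomorphism is the open immersion of `V` into `U` followed by the étale coordinate map. The two are
compared on the structure map and on each coordinate. -/
theorem coordHom_etale {U V : Y.Opens} (hV : IsAffineOpen V) (hVU : V ≤ U) {z : Fin n → Γ(Y, U)}
    (hz : IsCoordinateSystem U z) : (coordHom hVU z).Etale := by
  have hz' : Etale _ := hz
  let g : Spec Γ(Y, V) ⟶ U := hV.isoSpec.inv ≫ Y.homOfLE hVU
  have hg : g ≫ U.ι = hV.fromSpec := by simp [g, IsAffineOpen.isoSpec_inv_ι]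
  have key : g ≫ AffineSpace.homOfVector (U.ι ≫ (Y ↘ Spec (.of ℂ)))
      (fun i => U.topIso.inv.hom (z i)) =
      Spec.map (CommRingCat.ofHom (coordHom hVU z)) ≫ (AffineSpace.SpecIso (Fin n) (.of ℂ)).inv := by
    refine AffineSpace.hom_ext ?_ fun i => ?_
    · rw [Category.assoc, AffineSpace.homOfVector_over, reassoc_of% hg, fromSpec_over,
        Category.assoc, AffineSpace.SpecIso_inv_over, ← Spec.map_comp]
      congr 1
      ext a
      simp [coordHom]
    · have e2 := topIso_inv_comp_appTop hV hVU g hg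
      have e3 := Scheme.ΓSpecIso_inv_naturality (CommRingCat.ofHom (coordHom hVU z))
      have e4 : (Scheme.ΓSpecIso Γ(Y, V)).inv.hom (coordHom hVU z (MvPolynomial.X i)) =
          (Spec.map (CommRingCat.ofHom (coordHom hVU z))).appTop.hom
            ((Scheme.ΓSpecIso (.of (MvPolynomial (Fin n) ℂ))).inv.hom (MvPolynomial.X i)) :=
        congrArg (fun k => k.hom (MvPolynomial.X i)) e3
      have e5 : coordHom hVU z (MvPolynomial.X i) =
        (Y.presheaf.map (homOfLE hVU).op).hom (z i) := by simp [coordHom]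
      rw [Scheme.Hom.comp_appTop, Scheme.Hom.comp_appTop]
      refine (congrArg g.appTop.hom (AffineSpace.homOfVector_appTop_coord _ _ i)).trans ?_
      refine (congrArg (fun k => k.hom (z i)) e2).trans ?_
      refine (congrArg (Scheme.ΓSpecIso Γ(Y, V)).inv.hom e5.symm).trans (e4.trans ?_)
      exact (congrArg (Spec.map (CommRingCat.ofHom (coordHom hVU z))).appTop.hom
        (AffineSpace.SpecIso_inv_appTop_coord (.of ℂ) i)).symm
  have h2 : Etale (Spec.map (CommRingCat.ofHom (coordHom hVU z))) := by
    rw [← Category.comp_id (Spec.map _), ← (AffineSpace.SpecIso (Fin n) (.of ℂ)).inv_hom_id,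
      ← Category.assoc, ← key]
    infer_instance
  exact (HasRingHomProperty.Spec_iff (P := @Etale)).mp h2

end

/-! ### The universal jet on a coordinate chart -/

section

variable {Y : Scheme.{0}} [Y.Over (Spec (.of ℂ))] {n : ℕ}

/-- The coefficients `1, …, t` of the functions `z_i` along a jet. -/
noncomputable def coordCoeffs (U : Y.Opens) (z : Fin n → Γ(Y, U)) (t : ℕ) (γ : Jet Y t) :
    Fin n × Fin t → ℂ :=
  fun ik => coeffFun U (z ik.1) (ik.2 + 1) ik.2.isLt γ

theorem coeffFun_zero_eq {t : ℕ} {U : Y.Opens} {γ γ' : Jet Y t} (h : γ.point = γ'.point)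
    (f : Γ(Y, U)) : coeffFun U f 0 (Nat.zero_le t) γ = coeffFun U f 0 (Nat.zero_le t) γ' := by
  rw [← evalFun_point, ← evalFun_point, h]

/-- Both pullbacks to `ℂ[z]/(z^(t+1))` restrict to the same map on `ℂ[x_1, …, x_n]` and agree modulo
the nilpotent augmentation ideal, so they coincide by étaleness. -/
theorem Jet.eq_of_coordCoeffs_eq {U : Y.Opens} {z : Fin n → Γ(Y, U)} (hz : IsCoordinateSystem U z)
    {t : ℕ} {γ γ' : Jet Y t} (hU : γ.base ∈ U) (hp : γ.point = γ'.point)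
    (hc : coordCoeffs U z t γ = coordCoeffs U z t γ') : γ = γ' := by
  obtain ⟨V, hV, hγ, hVU⟩ := exists_isAffineOpen U hU
  have hb : γ'.base = γ.base := by rw [← γ'.base_point, ← hp, γ.base_point]
  have hγ' : γ'.base ∈ V := hb ▸ hγ
  refine Points.ext_of_pull hV hγ hγ' (eq_of_etale (coordHom_etale hV hVU hz)
    (isNilpotent_ker_truncAugmentation ℂ t) ?_ ?_)
  · refine MvPolynomial.ringHom_ext (fun a => ?_) fun i => ?_
    · simp [coordHom, Points.pull_scalars]
    · simp only [coordHom, RingHom.comp_apply, MvPolynomial.eval₂Hom_X']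
      refine jetRing_ext fun j hj => ?_
      rw [← coeffFun_of_mem hγ, ← coeffFun_of_mem hγ', coeffFun_res hVU _ hj hγ,
        coeffFun_res hVU _ hj hγ']
      -- The degree-zero coefficient is the value at the base point; the others are the prescribed
      -- ones.
      rcases j with _ | j
      · exact coeffFun_zero_eq hp _
      · exact congrFun hc (i, ⟨j, hj⟩)
  · ext f
    have := coeffFun_zero_eq hp f
    rwa [coeffFun_of_mem hγ, coeffFun_of_mem hγ', ← jetAugmentation_eq, ← jetAugmentation_eq] at this

/-- The expansion of the `i`-th coordinate along the universal jet. -/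
noncomputable def universalExpansion (A : Type) [CommRing A] (t : ℕ) (a : A) (i : Fin n) :
    (MvPolynomial (Fin n × Fin t) A)⟦X⟧ :=
  PowerSeries.mk fun j =>
    match j with
    | 0 => MvPolynomial.C a
    | k + 1 => if h : k < t then MvPolynomial.X (i, ⟨k, h⟩) else 0

/-- Send `x_i` to `z_i` plus a generic tail with indeterminate coefficients. Modulo the augmentation
ideal this is the constant inclusion of `Γ(Y, V)` into the polynomial ring, so étaleness extends it
from the coordinates to all functions on `V`. -/
theorem exists_universalJet {U V : Y.Opens} (hV : IsAffineOpen V) (hVU : V ≤ U)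
    {z : Fin n → Γ(Y, U)} (hz : IsCoordinateSystem U z) (t : ℕ) :
    ∃ w : Γ(Y, V) →+* Trunc (MvPolynomial (Fin n × Fin t) Γ(Y, V)) t,
      (∀ a, w (scalars Y V a) =
        Ideal.Quotient.mk _ (PowerSeries.C (MvPolynomial.C (scalars Y V a)))) ∧
      (∀ i, w ((Y.presheaf.map (homOfLE hVU).op).hom (z i)) = Ideal.Quotient.mk _
        (universalExpansion _ t ((Y.presheaf.map (homOfLE hVU).op).hom (z i)) i)) ∧
      ∀ f, truncAugmentation _ t (w f) = MvPolynomial.C f := by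
  let u : MvPolynomial (Fin n) ℂ →+* Trunc (MvPolynomial (Fin n × Fin t) Γ(Y, V)) t :=
    MvPolynomial.eval₂Hom ((Ideal.Quotient.mk _).comp
      (PowerSeries.C.comp (MvPolynomial.C.comp (scalars Y V)))) fun i =>
      Ideal.Quotient.mk _
        (universalExpansion _ t ((Y.presheaf.map (homOfLE hVU).op).hom (z i)) i)
  obtain ⟨w, hw, hw'⟩ := exists_lift_of_etale (coordHom_etale hV hVU hz) u MvPolynomial.C
    (truncAugmentation_surjective _ t) (isNilpotent_ker_truncAugmentation _ t) (by
      refine MvPolynomial.ringHom_ext (fun a => ?_) fun i => ?_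
      · simp only [u, coordHom, RingHom.comp_apply, MvPolynomial.eval₂Hom_C]
        exact PowerSeries.constantCoeff_C _
      · simp only [u, coordHom, RingHom.comp_apply, MvPolynomial.eval₂Hom_X']
        change PowerSeries.constantCoeff (universalExpansion _ t _ i) = _
        rw [← PowerSeries.coeff_zero_eq_constantCoeff_apply, universalExpansion, PowerSeries.coeff_mk])
  refine ⟨w, fun a => ?_, fun i => ?_, fun f => congrArg (fun k => k f) hw'⟩
  · have := congrArg (fun k => k (MvPolynomial.C a)) hw
    simpa [u, coordHom] using this
  · have := congrArg (fun k => k (MvPolynomial.X i)) hw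
    simpa [u, coordHom] using this

/-- Every closed point of `V` and every vector of coefficients come from a jet, along which the
coefficients of functions are polynomial in the given data. -/
theorem exists_jet {U V : Y.Opens} (hV : IsAffineOpen V) (hVU : V ≤ U)
    {z : Fin n → Γ(Y, U)} (hz : IsCoordinateSystem U z) (t : ℕ) :
    ∃ F : Γ(Y, V) → ℕ → MvPolynomial (Fin n × Fin t) Γ(Y, V),
      ∀ (y : CPoint Y) (hy : y.base ∈ V) (c : Fin n × Fin t → ℂ),
        ∃ γ : Jet Y t, γ.base ∈ V ∧ γ.point = y ∧ coordCoeffs U z t γ = c ∧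
          ∀ (f : Γ(Y, V)) (i : ℕ) (hi : i ≤ t),
            coeffFun V f i hi γ = (F f i).eval₂ (y.pull V hy) c := by
  obtain ⟨w, hw1, hw2, hw3⟩ := exists_universalJet hV hVU hz t
  -- The polynomials are coefficients of a chosen power series representative of the universal
  -- expansion. The choice precedes `y` and `c`, and coefficients in degrees at most `t` do not
  -- depend on it.
  refine ⟨fun f i => PowerSeries.coeff i (Function.surjInv Ideal.Quotient.mk_surjective (w f)),
    fun y hy c => ?_⟩
  let e : MvPolynomial (Fin n × Fin t) Γ(Y, V) →+* ℂ := MvPolynomial.eval₂Hom (y.pull V hy) c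
  let a : Γ(Y, V) →+* JetRing t := (truncMap t e).comp w
  have ha : a.comp (scalars Y V) = algebraMap ℂ (JetRing t) := by
    ext r
    simp only [a, RingHom.comp_apply, hw1, truncMap_mk]
    rw [PowerSeries.map_C]
    simp only [e, MvPolynomial.eval₂Hom_C, Points.pull_scalars]
    rfl
  have hb := Points.base_ofHom hV a ha
  have hpull := Points.pull_ofHom hV a ha hb
  refine ⟨Points.ofHom hV a ha, hb, ?_, ?_, fun f i hi => ?_⟩
  · have hb' : (Jet.point (Points.ofHom hV a ha)).base ∈ V := by rwa [Jet.base_point]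
    refine Points.ext_of_pull hV hb' hy ?_
    ext f
    refine (Points.pull_map_apply _ _ V hb hb' f).trans ?_
    rw [hpull, jetAugmentation_eq_trunc]
    simp only [a, RingHom.comp_apply, truncAugmentation_truncMap, hw3]
    simp [e]
  · ext ⟨i, k⟩
    simp only [coordCoeffs]
    rw [← coeffFun_res hVU _ _ hb, coeffFun_of_mem hb, hpull]
    simp only [a, RingHom.comp_apply, hw2, truncMap_mk]
    rw [jetCoeff_mk, PowerSeries.coeff_map, universalExpansion, PowerSeries.coeff_mk]
    simp [e]
  · rw [coeffFun_of_mem hb, hpull]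
    simp only [a, RingHom.comp_apply]
    conv_lhs => rw [← Function.surjInv_eq Ideal.Quotient.mk_surjective (w f)]
    rw [truncMap_mk, jetCoeff_mk, PowerSeries.coeff_map]
    rfl

/-- The chart `V × ℂ^ι` of `Y × ℂ^ι`. -/
theorem mem_pointProdCharts (V : Y.Opens) (ι : Type) :
    ({y : CPoint Y | y.base ∈ V} ×ˢ (Set.univ : Set (ι → ℂ)),
      {f | ∃ g ∈ {φ : CPoint Y → ℂ | ∃ f : Γ(Y, V), φ = evalFun V f}, f = fun x => g x.1} ∪
      {f | ∃ g ∈ {f : (ι → ℂ) → ℂ | ∃ i, f = fun x => x i}, f = fun x => g x.2}) ∈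
        ZariskiCharts.charts (X := CPoint Y × (ι → ℂ)) :=
  ⟨_, mem_pointCharts Y V, (Set.univ, {f | ∃ i, f = fun x => x i}), rfl, rfl⟩

theorem exists_regular_eval₂ {V : Y.Opens} {ι : Type} (F : MvPolynomial ι Γ(Y, V)) :
    ∃ g : CPoint Y × (ι → ℂ) → ℂ, (∀ S x, x.1.base ∈ V → IsRegularAt S g x) ∧
      ∀ (y : CPoint Y) (hy : y.base ∈ V) (c : ι → ℂ), g (y, c) = F.eval₂ (y.pull V hy) c := by
  induction F using MvPolynomial.induction_on with
  | C a =>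
    exact ⟨fun x => evalFun V a x.1, fun S x hx => isRegularAt_of_mem (mem_pointProdCharts V ι)
      (Or.inl ⟨_, ⟨a, rfl⟩, rfl⟩) ⟨hx, trivial⟩, fun y hy c => by simp [evalFun_of_mem hy]⟩
  | add p q hp hq =>
    obtain ⟨g, hg, hg'⟩ := hp
    obtain ⟨h, hh, hh'⟩ := hq
    exact ⟨g + h, fun S x hx => (hg S x hx).add (hh S x hx), fun y hy c => by
      simp [hg' y hy, hh' y hy]⟩
  | mul_X p i hp =>
    obtain ⟨g, hg, hg'⟩ := hp
    exact ⟨g * fun x => x.2 i, fun S x hx => (hg S x hx).mul (isRegularAt_of_mem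
      (mem_pointProdCharts V ι) (Or.inr ⟨_, ⟨i, rfl⟩, rfl⟩) ⟨hx, trivial⟩), fun y hy c => by
      simp [hg' y hy]⟩

open Classical in
/-- The jet with a given base point and given coefficients of the coordinates. -/
noncomputable def jetOfCoeffs (U : Y.Opens) (z : Fin n → Γ(Y, U)) (t : ℕ)
    (x : CPoint Y × (Fin n × Fin t → ℂ)) : Jet Y t :=
  if h : ∃ γ : Jet Y t, γ.point = x.1 ∧ coordCoeffs U z t γ = x.2 then h.choose
  -- The constant jet serves as a default value; it is not reached for base points in `U` when `z`
  -- is a coordinate system.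
  else x.1.map (Algebra.ofId ℂ (JetRing t))

theorem jetOfCoeffs_spec {U : Y.Opens} {z : Fin n → Γ(Y, U)} (hz : IsCoordinateSystem U z) (t : ℕ)
    {x : CPoint Y × (Fin n × Fin t → ℂ)} (hx : x.1.base ∈ U) :
    (jetOfCoeffs U z t x).point = x.1 ∧ coordCoeffs U z t (jetOfCoeffs U z t x) = x.2 := by
  have h : ∃ γ : Jet Y t, γ.point = x.1 ∧ coordCoeffs U z t γ = x.2 := by
    obtain ⟨V, hV, hxV, hVU⟩ := exists_isAffineOpen U hx
    obtain ⟨_, hF⟩ := exists_jet hV hVU hz t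
    obtain ⟨γ, _, h1, h2, _⟩ := hF x.1 hxV x.2
    exact ⟨γ, h1, h2⟩
  rw [jetOfCoeffs, dif_pos h]
  exact h.choose_spec

theorem base_jetOfCoeffs {U : Y.Opens} {z : Fin n → Γ(Y, U)} (hz : IsCoordinateSystem U z) (t : ℕ)
    {x : CPoint Y × (Fin n × Fin t → ℂ)} (hx : x.1.base ∈ U) :
    (jetOfCoeffs U z t x).base = x.1.base := by
  rw [← Jet.base_point, (jetOfCoeffs_spec hz t hx).1]

/-- Uniqueness of the jet makes the choice in `jetOfCoeffs` canonical over `U`. -/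
theorem jetOfCoeffs_coordCoeffs {U : Y.Opens} {z : Fin n → Γ(Y, U)} (hz : IsCoordinateSystem U z)
    (t : ℕ) {γ : Jet Y t} (hγ : γ.base ∈ U) :
    jetOfCoeffs U z t (γ.point, coordCoeffs U z t γ) = γ := by
  have hx : γ.point.base ∈ U := γ.base_point ▸ hγ
  have h := jetOfCoeffs_spec hz t (x := (γ.point, coordCoeffs U z t γ)) hx
  refine Jet.eq_of_coordCoeffs_eq hz ?_ h.1 h.2
  rwa [base_jetOfCoeffs hz t (x := (γ.point, coordCoeffs U z t γ)) hx]

/-- On a small affine `V` the chosen jet is the specialization of the universal one, so each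
coefficient of a function along it is a polynomial in the free coordinates over `Γ(Y, V)`, evaluated
at the base point. -/
theorem isRegularMapOn_jetOfCoeffs {U : Y.Opens} {z : Fin n → Γ(Y, U)}
    (hz : IsCoordinateSystem U z) (t : ℕ) :
    IsRegularMapOn (jetOfCoeffs U z t)
      ({y : CPoint Y | y.base ∈ U} ×ˢ (Set.univ : Set (Fin n × Fin t → ℂ))) := by
  rintro x ⟨hx, -⟩ _ ⟨U', rfl⟩ hxU'
  have hxU' : x.1.base ∈ U' := base_jetOfCoeffs hz t hx ▸ hxU'
  refine ⟨⟨_, isOpen_chart (mem_pointProdCharts U' _), ⟨hxU', trivial⟩, fun a ha => ?_⟩, ?_⟩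
  · change (jetOfCoeffs U z t a).base ∈ U'
    rw [base_jetOfCoeffs hz t ha.1.1]
    exact ha.2.1
  · rintro _ ⟨f, i, hi, rfl⟩
    obtain ⟨V, hV, hxV, hVU⟩ := exists_isAffineOpen (U ⊓ U') (y := x.1.base) ⟨hx, hxU'⟩
    obtain ⟨F, hF⟩ := exists_jet hV (hVU.trans inf_le_left) hz t
    have hVU' : V ≤ U' := hVU.trans inf_le_right
    obtain ⟨g, hg, hg'⟩ :=
      exists_regular_eval₂ (F ((Y.presheaf.map (homOfLE hVU').op).hom f) i)
    refine IsRegularAt.of_inter (isOpen_chart (mem_pointProdCharts V _)) ⟨hxV, trivial⟩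
      ((hg _ x hxV).congr ?_)
    rintro ⟨y, c⟩ ⟨-, hy, -⟩
    obtain ⟨γ, h1, h2, h3, h4⟩ := hF y hy c
    have e : jetOfCoeffs U z t (y, c) = γ := by
      rw [← jetOfCoeffs_coordCoeffs hz t (hVU h1).1, h2, h3]
    rw [Function.comp_apply, e, hg' y hy c, ← h4 _ i hi, coeffFun_res hVU' f hi h1]

theorem isRegularMapOn_coordCoeffs (U : Y.Opens) (z : Fin n → Γ(Y, U)) (t : ℕ) :
    IsRegularMapOn (coordCoeffs U z t) {γ : Jet Y t | γ.base ∈ U} :=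
  isRegularMapOn_pi fun _ hγ ik =>
    isRegularAt_of_mem (mem_jetCharts Y t U) ⟨z ik.1, ik.2 + 1, ik.2.isLt, rfl⟩ hγ

end

/-! ### The trivialization of the jet space over a chart -/

section

variable {Y : Scheme.{0}} [Y.Over (Spec (.of ℂ))] {n : ℕ} {D : EffDivisor Y} (c : SNCChart n D)

theorem isRegularMapOn_trivialization (t : ℕ) :
    IsRegularMapOn (c.trivialization t) {γ : Jet Y t | γ.base ∈ c.U} :=
  (isRegularMapOn_point _).prodMk (isRegularMapOn_coordCoeffs c.U c.z t)

theorem isIsoOn_trivialization (t : ℕ) : IsIsoOn (c.trivialization t) {γ : Jet Y t | γ.base ∈ c.U}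
    ({y : CPoint Y | y.base ∈ c.U} ×ˢ (Set.univ : Set (Fin n × Fin t → ℂ))) := by
  refine ⟨(isRegularMapOn_trivialization c t).isMorphismOn fun γ hγ => ⟨?_, trivial⟩,
    jetOfCoeffs c.U c.z t, (isRegularMapOn_jetOfCoeffs c.coord t).isMorphismOn fun x hx => ?_,
    fun _ hγ => jetOfCoeffs_coordCoeffs c.coord t hγ, fun x hx => ?_⟩
  · exact (γ.base_point ▸ hγ : γ.point.base ∈ c.U)
  · change (jetOfCoeffs c.U c.z t x).base ∈ c.U
    rw [base_jetOfCoeffs c.coord t hx.1]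
    exact hx.1
  · have := jetOfCoeffs_spec c.coord t hx.1
    exact Prod.ext this.1 this.2

end

/-! ### Local equations -/

section

variable {Y : Scheme.{0}} {n : ℕ}

theorem EffDivisor.ideal_single (P : PrimeDivisor Y) :
    EffDivisor.ideal (Finsupp.single P 1) = Scheme.IdealSheafData.vanishingIdeal P.carrier :=
  (Finsupp.prod_single_index (h := fun (P : PrimeDivisor Y) (a : ℕ) =>
    Scheme.IdealSheafData.vanishingIdeal P.carrier ^ a) (pow_zero _)).trans (pow_one _)

/-- The vanishing ideal of the empty set is the unit ideal. With this, components that miss the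
chart are treated on the same footing as those that meet it. -/
theorem isLocalEquation_one {P : PrimeDivisor Y} {U : Y.Opens}
    (h : ¬ ((P.carrier : Set Y) ∩ U).Nonempty) :
    IsLocalEquation (Finsupp.single P 1) U (1 : Γ(Y, U)) := by
  intro V hV
  rw [EffDivisor.ideal_single, map_one, Ideal.span_singleton_one,
    Scheme.IdealSheafData.vanishingIdeal_ideal]
  have : V.2.fromSpec ⁻¹' (P.carrier : Set Y) = ∅ := by
    refine Set.eq_empty_of_forall_notMem fun x hx => h ⟨V.2.fromSpec x, hx, hV ?_⟩
    have := V.2.range_fromSpec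
    exact this.le ⟨x, rfl⟩
  exact (congrArg PrimeSpectrum.vanishingIdeal this).trans PrimeSpectrum.vanishingIdeal_empty

/-- The ideal of sections over `V` as a multiplicative function of the ideal sheaf. -/
noncomputable def idealSections (V : Y.affineOpens) : Y.IdealSheafData →* Ideal Γ(Y, V) where
  toFun I := I.ideal V
  map_one' := Ideal.one_eq_top.symm
  map_mul' _ _ := rfl

theorem isLocalEquation_prod {D : EffDivisor Y} {U : Y.Opens} (g : D.support → Γ(Y, U))
    (hg : ∀ P : D.support, IsLocalEquation (Finsupp.single P.1 1) U (g P)) :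
    IsLocalEquation D U (∏ P, g P ^ D P.1) := by
  intro V hV
  change idealSections V (EffDivisor.ideal D) = Ideal.span {_}
  rw [EffDivisor.ideal, Finsupp.prod, map_prod, map_prod, ← Ideal.prod_span_singleton,
    ← Finset.prod_coe_sort]
  refine Finset.prod_congr rfl fun P _ => ?_
  rw [map_pow, map_pow, ← Ideal.span_singleton_pow, ← hg P V hV, EffDivisor.ideal_single]
  rfl

variable [Y.Over (Spec (.of ℂ))]

/-- The vanishing ideal sheaf has support `P`, and on an affine neighbourhood it is generated by
`g`; hence `P` is there the zero locus of `g`. -/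
theorem mem_carrier_iff {P : PrimeDivisor Y} {U : Y.Opens} {g : Γ(Y, U)}
    (hg : IsLocalEquation (Finsupp.single P 1) U g) {y : CPoint Y} (hy : y.base ∈ U) :
    y.base ∈ P.carrier ↔ evalFun U g y = 0 := by
  obtain ⟨V, hV, hyV, hVU⟩ := exists_isAffineOpen U hy
  have h1 := hg ⟨V, hV⟩ hVU
  rw [EffDivisor.ideal_single] at h1
  have h2 := Scheme.IdealSheafData.mem_support_iff_of_mem
    (I := Scheme.IdealSheafData.vanishingIdeal P.carrier) (U := ⟨V, hV⟩) hyV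
  rw [h1] at h2
  rw [← evalFun_res hVU g hyV, evalFun_of_mem hyV, Points.pull_eq_zero_iff]
  refine Iff.trans ?_ (h2.trans ?_)
  · rw [← SetLike.mem_coe, ← SetLike.mem_coe,
      Scheme.IdealSheafData.coe_support_vanishingIdeal]
  · rw [Scheme.zeroLocus_span, Scheme.zeroLocus_singleton]
    rfl

theorem Points.pull_dvd_pull {R : Type} [CommRing R] [IsLocalRing R] [Algebra ℂ R]
    {D : EffDivisor Y} (γ : Points Y R) {U U' : Y.Opens} {g : Γ(Y, U)}
    {g' : Γ(Y, U')} (hU : γ.base ∈ U) (hU' : γ.base ∈ U') (h : IsLocalEquation D U g)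
    (h' : IsLocalEquation D U' g') : γ.pull U hU g ∣ γ.pull U' hU' g' := by
  obtain ⟨V, hV, hxV, hVU⟩ := exists_isAffineOpen (U ⊓ U') (y := γ.base) ⟨hU, hU'⟩
  have hV1 : V ≤ U := hVU.trans inf_le_left
  have hV2 : V ≤ U' := hVU.trans inf_le_right
  have e := (h ⟨V, hV⟩ hV1).symm.trans (h' ⟨V, hV⟩ hV2)
  rw [← γ.pull_map hV1 hxV g, ← γ.pull_map hV2 hxV g']
  exact map_dvd _ (Ideal.mem_span_singleton.mp (e ▸ Ideal.mem_span_singleton_self _))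

namespace SNCChart

variable {D : EffDivisor Y} (c : SNCChart n D)

open Classical in
/-- The equation of the component `P` of `D` on a chart. -/
noncomputable def component (P : D.support) : Γ(Y, c.U) :=
  if h : ((P.1.carrier : Set Y) ∩ c.U).Nonempty then c.z (c.e ⟨P, h⟩) else 1

theorem component_of_nonempty {P : D.support} (h : ((P.1.carrier : Set Y) ∩ c.U).Nonempty) :
    c.component P = c.z (c.e ⟨P, h⟩) := dif_pos h

theorem isLocalEquation_component (P : D.support) :
    IsLocalEquation (Finsupp.single P.1 1) c.U (c.component P) := by
  by_cases h : ((P.1.carrier : Set Y) ∩ c.U).Nonempty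
  · rw [component, dif_pos h]
    exact c.eqn ⟨P, h⟩
  · rw [component, dif_neg h]
    exact isLocalEquation_one h

end SNCChart

/-! ### Contact order of jets -/

/-- The class of `z` in `ℂ[z]/(z^(t+1))`. -/
noncomputable abbrev jetVar (t : ℕ) : JetRing t := Ideal.Quotient.mk _ PowerSeries.X

/-- The jet `γ` has contact order `m` with `D`. -/
def HasContact (D : EffDivisor Y) (t m : ℕ) (γ : Jet Y t) : Prop :=
  ∀ (U : Y.Opens) (g : Γ(Y, U)) (hU : γ.base ∈ U), IsLocalEquation D U g →
    jetVar t ^ m ∣ γ.pull U hU g ∧ ¬ jetVar t ^ (m + 1) ∣ γ.pull U hU g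

theorem hasContact_iff {D : EffDivisor Y} {t m : ℕ} {γ : Jet Y t} {U : Y.Opens} {g : Γ(Y, U)}
    (hU : γ.base ∈ U) (hg : IsLocalEquation D U g) : HasContact D t m γ ↔
      jetVar t ^ m ∣ γ.pull U hU g ∧ ¬ jetVar t ^ (m + 1) ∣ γ.pull U hU g :=
  ⟨fun h => h U g hU hg, fun h _ _ hU' hg' => ⟨h.1.trans (γ.pull_dvd_pull hU hU' hg hg'),
    fun h' => h.2 (h'.trans (γ.pull_dvd_pull hU' hU hg' hg))⟩⟩

theorem jetVar_pow_dvd_iff {t m : ℕ} (hm : m ≤ t + 1) (x : JetRing t) :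
    jetVar t ^ m ∣ x ↔ ∀ (i : ℕ) (hi : i < m),
      jetCoeff t i (Nat.lt_succ_iff.mp (hi.trans_le hm)) x = 0 := by
  obtain ⟨f, rfl⟩ := Ideal.Quotient.mk_surjective x
  rw [X_pow_dvd_mk_iff hm, PowerSeries.X_pow_dvd_iff]
  rfl

theorem hasContact_iff_coeffFun {D : EffDivisor Y} {t m : ℕ} (hm : m ≤ t) {γ : Jet Y t}
    {U : Y.Opens} {g : Γ(Y, U)} (hU : γ.base ∈ U) (hg : IsLocalEquation D U g) :
    HasContact D t m γ ↔ (∀ (i : ℕ) (hi : i < m), coeffFun U g i (hi.le.trans hm) γ = 0) ∧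
      coeffFun U g m hm γ ≠ 0 := by
  rw [hasContact_iff hU hg, jetVar_pow_dvd_iff (Nat.le_succ_of_le hm),
    jetVar_pow_dvd_iff (Nat.succ_le_succ hm)]
  simp only [coeffFun_of_mem hU]
  constructor
  · rintro ⟨h1, h2⟩
    refine ⟨h1, fun h3 => h2 fun i hi => ?_⟩
    rcases Nat.lt_succ_iff_lt_or_eq.mp hi with hi | rfl
    · exact h1 i hi
    · exact h3
  · rintro ⟨h1, h2⟩
    exact ⟨h1, fun h3 => h2 (h3 m (Nat.lt_succ_self m))⟩

/-- The order of a power series is decided by its coefficients up to that order, and truncation at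
`t ≥ m` preserves them. -/
theorem hasContact_truncArc_iff {D : EffDivisor Y} {t m : ℕ} (hm : m ≤ t) {γ : Arc Y}
    {U : Y.Opens} {g : Γ(Y, U)} (hU : γ.base ∈ U) (hg : IsLocalEquation D U g) :
    HasContact D t m (truncArc t γ) ↔ contactOrder D γ = m := by
  have hU' : (truncArc t γ).base ∈ U := (base_truncArc t γ).symm ▸ hU
  rw [hasContact_iff_coeffFun hm hU' hg, contactOrder_eq γ hU hg, PowerSeries.order_eq_nat,
    and_comm]
  simp only [coeffFun_of_mem hU', pull_truncArc t γ U hU hU', jetCoeff_mk]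

/-! ### Locally closed sets of jets -/

/-- Local closedness at `x` amounts to an open neighbourhood on which `s` contains its closure. If
`s ∩ N = O ∩ C`, then `N ∩ O` is such a neighbourhood. -/
theorem isLocallyClosed_of_forall_exists_nhd {X : Type} [TopologicalSpace X] {s : Set X}
    (h : ∀ x ∈ s, ∃ N, IsOpen N ∧ x ∈ N ∧ IsLocallyClosed (s ∩ N)) : IsLocallyClosed s := by
  refine ((isLocallyClosed_tfae s).out 0 3).mpr fun x hx => ?_
  obtain ⟨N, hN, hxN, O, C, hO, hC, e⟩ := h x hx
  have hx' : x ∈ O ∩ C := e ▸ ⟨hx, hxN⟩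
  refine ⟨N ∩ O, ⟨hxN, hx'.1⟩, hN.inter hO, fun y hy => ?_⟩
  have h1 : y ∈ closure (N ∩ O ∩ s) := (hN.inter hO).inter_closure hy
  have h2 : N ∩ O ∩ s ⊆ C := fun a ha => (e.le ⟨ha.2, ha.1.1⟩).2
  exact (e.ge ⟨hy.1.2, closure_minimal h2 hC h1⟩).1

theorem IsZariskiLocallyClosed.isConstructibleSet {X : Type} [ZariskiCharts X] {S : Set X}
    (h : IsZariskiLocallyClosed S) : IsConstructibleSet S :=
  ⟨{S}, Set.finite_singleton S, Set.pairwiseDisjoint_singleton _ _,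
    fun _ hT => (Set.mem_singleton_iff.mp hT) ▸ h, Set.sUnion_singleton S⟩

theorem IsZariskiLocallyClosed.inter {X : Type} [ZariskiCharts X] {S T : Set X}
    (hS : IsZariskiLocallyClosed S) (hT : IsZariskiLocallyClosed T) :
    IsZariskiLocallyClosed (S ∩ T) :=
  @IsLocallyClosed.inter X (zariski X) S T hS hT

theorem IsZariskiLocallyClosed.setOf_forall {X ι : Type} [ZariskiCharts X] [Finite ι]
    {p : ι → X → Prop} (h : ∀ i, IsZariskiLocallyClosed {x | p i x}) :
    IsZariskiLocallyClosed {x | ∀ i, p i x} := by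
  have := Fintype.ofFinite ι
  have key : ∀ s : Finset ι, IsZariskiLocallyClosed {x | ∀ i ∈ s, p i x} := by
    intro s
    classical
    induction s using Finset.induction_on with
    | empty =>
      exact ⟨Set.univ, Set.univ, @isOpen_univ X (zariski X), @isClosed_univ X (zariski X), by simp⟩
    | insert i s _ ih =>
      convert (h i).inter ih using 1
      ext x
      simp
  simpa using key Finset.univ

theorem isZariskiLocallyClosed_jets_over (U : Y.Opens) (t : ℕ) :
    IsZariskiLocallyClosed {γ : Jet Y t | γ.base ∈ U} :=
  @IsOpen.isLocallyClosed _ _ (zariski _) (isOpen_chart (mem_jetCharts Y t U))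

theorem isOpen_coeffFun_ne_zero {t : ℕ} (U : Y.Opens) (g : Γ(Y, U)) {i : ℕ} (hi : i ≤ t) :
    IsOpen[zariski (Jet Y t)] {γ : Jet Y t | γ.base ∈ U ∧ coeffFun U g i hi γ ≠ 0} :=
  isOpen_chartLocus (mem_jetCharts Y t U) (Algebra.subset_adjoin ⟨g, i, hi, rfl⟩)

/-- Over the domain of a local equation this is one nonvanishing and finitely many vanishing
coefficients. The closed set is a complement taken in the whole jet space, so it also contains jets
off `U`; the open set excludes them. -/
theorem isZariskiLocallyClosed_hasContact {D : EffDivisor Y} {t m : ℕ} (hm : m ≤ t)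
    (hD : ∀ y : Y, ∃ (U : Y.Opens) (g : Γ(Y, U)), y ∈ U ∧ IsLocalEquation D U g) :
    IsZariskiLocallyClosed {γ : Jet Y t | HasContact D t m γ} := by
  refine @isLocallyClosed_of_forall_exists_nhd _ (zariski _) _ fun γ _ => ?_
  obtain ⟨U, g, hU, hg⟩ := hD γ.base
  refine ⟨_, isOpen_chart (mem_jetCharts Y t U), hU, ?_⟩
  refine ⟨{γ | γ.base ∈ U ∧ coeffFun U g m hm γ ≠ 0},
    ⋂ (i : ℕ) (hi : i < m), {γ | γ.base ∈ U ∧ coeffFun U g i (hi.le.trans hm) γ ≠ 0}ᶜ,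
    isOpen_coeffFun_ne_zero U g hm, ?_, ?_⟩
  · refine @isClosed_iInter _ _ (zariski _) _ fun i => @isClosed_iInter _ _ (zariski _) _ fun hi => ?_
    exact (@isClosed_compl_iff _ (zariski _) _).mpr (isOpen_coeffFun_ne_zero U g _)
  · ext δ
    simp only [Set.mem_inter_iff, Set.mem_ofPred_eq, Set.mem_iInter, Set.mem_compl_iff, not_and,
      not_not]
    constructor
    · rintro ⟨h, hδ⟩
      obtain ⟨h1, h2⟩ := (hasContact_iff_coeffFun hm hδ hg).mp h
      exact ⟨⟨hδ, h2⟩, fun i hi _ => h1 i hi⟩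
    · rintro ⟨⟨hδ, h2⟩, h1⟩
      exact ⟨(hasContact_iff_coeffFun hm hδ hg).mpr ⟨fun i hi => h1 i hi hδ, h2⟩, hδ⟩

theorem isCylinder_contactOrder {D : EffDivisor Y} (s : ℕ)
    (hD : ∀ y : Y, ∃ (U : Y.Opens) (g : Γ(Y, U)), y ∈ U ∧ IsLocalEquation D U g) :
    IsCylinder {γ : Arc Y | contactOrder D γ = s} := by
  refine ⟨s, _, (isZariskiLocallyClosed_hasContact le_rfl hD).isConstructibleSet, ?_⟩
  ext γ
  obtain ⟨U, g, hU, hg⟩ := hD γ.base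
  exact (hasContact_truncArc_iff le_rfl hU hg).symm

theorem isCylinder_iInter_contactOrder {D : EffDivisor Y} (hD : IsSNC n D) (m : D.support → ℕ) :
    IsCylinder {γ : Arc Y | ∀ P, contactOrder (Finsupp.single P.1 1) γ = m P} := by
  have hm : ∀ P, m P ≤ ∑ P, m P := fun P =>
    Finset.single_le_sum (fun _ _ => Nat.zero_le _) (Finset.mem_univ P)
  -- The sum is only a convenient common upper bound for the `m P`.
  refine ⟨∑ P, m P, {γ | ∀ P : D.support, HasContact (Finsupp.single P.1 1) _ (m P) γ},
    (IsZariskiLocallyClosed.setOf_forall fun P =>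
      isZariskiLocallyClosed_hasContact (hm P) fun y => ?_).isConstructibleSet, ?_⟩
  · obtain ⟨c, hc⟩ := hD y
    exact ⟨c.U, _, hc, c.isLocalEquation_component P⟩
  · ext γ
    obtain ⟨c, hc⟩ := hD γ.base
    exact forall_congr' fun P =>
      (hasContact_truncArc_iff (hm P) hc (c.isLocalEquation_component P)).symm

end

/-! ### Free coefficients -/

section Free

variable {K : Type} {n : ℕ} {m : K → ℕ} (e : {P : K // 0 < m P} → Fin n) (t : ℕ)

/-- The coefficients of the coordinates that are not constrained by the contact orders `m`, the
coordinate `e P` being the equation of `P`. -/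
def IsFreeIndex (ik : Fin n × Fin t) : Prop := ∀ P, e P = ik.1 → m P.1 ≤ ik.2

/-- The index of the leading coefficient of the coordinate `e P`. -/
def leadingIndex (hmt : ∀ P, m P ≤ t) (P : {P : K // 0 < m P}) : Fin n × Fin t :=
  (e P, ⟨m P.1 - 1, by have := P.2; have := hmt P.1; omega⟩)

variable {e t}

theorem leadingIndex_injective (he : Function.Injective e) (hmt : ∀ P, m P ≤ t) :
    Function.Injective (leadingIndex e t hmt) :=
  fun _ _ h => he (congrArg Prod.fst h)

theorem not_isFreeIndex_leadingIndex (hmt : ∀ P, m P ≤ t) (P : {P : K // 0 < m P}) :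
    ¬ IsFreeIndex e t (leadingIndex e t hmt P) := fun h => by
  have h1 := h P rfl
  have h2 := P.2
  simp only [leadingIndex] at h1
  omega

/-- The constrained indices are the pairs `(e P, k)` with `k < m P`. Injectivity of `e` makes these
blocks disjoint, so there are `∑ P, m P` of them. Index `k` stands for degree `k + 1`, so a block
consists of degrees `1, …, m P`. -/
theorem card_isFreeIndex [Fintype K] (he : Function.Injective e) (hmt : ∀ P, m P ≤ t) :
    Nat.card {ik // IsFreeIndex e t ik} + ∑ P, m P = t * n := by
  classical
  let f : (Σ P : K, Fin (m P)) → Fin n × Fin t := fun x =>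
    (e ⟨x.1, x.2.pos⟩, ⟨x.2, x.2.isLt.trans_le (hmt x.1)⟩)
  have hf : Function.Injective f := by
    rintro ⟨P, k⟩ ⟨Q, l⟩ h
    have h1 : P = Q := congrArg Subtype.val (he (congrArg Prod.fst h))
    subst h1
    have h2 : k = l := Fin.ext (congrArg (fun x : Fin n × Fin t => (x.2 : ℕ)) h)
    rw [h2]
  have hr : ∀ ik, ¬ IsFreeIndex e t ik ↔ ik ∈ Finset.univ.image f := by
    rintro ⟨i, k⟩
    simp only [IsFreeIndex, Finset.mem_image, Finset.mem_univ, true_and, not_forall, not_le]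
    constructor
    · rintro ⟨P, rfl, hk⟩
      exact ⟨⟨P.1, ⟨k, hk⟩⟩, rfl⟩
    · rintro ⟨x, hx⟩
      refine ⟨⟨x.1, x.2.pos⟩, congrArg Prod.fst hx, ?_⟩
      have : (x.2 : ℕ) = k := congrArg (fun x : Fin n × Fin t => (x.2 : ℕ)) hx
      exact this ▸ x.2.isLt
  have h1 : (Finset.univ.image f).card = ∑ P, m P := by
    rw [Finset.card_image_of_injective _ hf, Finset.card_univ, Fintype.card_sigma]
    simp
  have h2 : Nat.card {ik // IsFreeIndex e t ik} = ((Finset.univ.image f)ᶜ).card := by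
    rw [Nat.card_eq_fintype_card, Fintype.card_subtype]
    congr 1
    ext ik
    simp only [Finset.mem_filter, Finset.mem_univ, true_and, Finset.mem_compl, ← hr, not_not]
  rw [h2, ← h1, Finset.card_compl_add_card, Fintype.card_prod, Fintype.card_fin, Fintype.card_fin,
    mul_comm]

open Classical in
/-- Put together the free and the leading coefficients, all the others being zero. -/
noncomputable def insertCoeffs {N : Type} (κ : N ≃ {ik // IsFreeIndex e t ik})
    (hmt : ∀ P, m P ≤ t) (x : (N → ℂ) × ({P : K // 0 < m P} → ℂ)) (ik : Fin n × Fin t) : ℂ :=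
  if h : IsFreeIndex e t ik then x.1 (κ.symm ⟨ik, h⟩)
  else if h : ∃ P, leadingIndex e t hmt P = ik then x.2 h.choose else 0

variable {N : Type} (κ : N ≃ {ik // IsFreeIndex e t ik}) (hmt : ∀ P, m P ≤ t)

theorem insertCoeffs_free (x : (N → ℂ) × ({P : K // 0 < m P} → ℂ)) (l : N) :
    insertCoeffs κ hmt x (κ l) = x.1 l := by
  rw [insertCoeffs, dif_pos (κ l).2]
  simp

theorem insertCoeffs_leadingIndex (he : Function.Injective e)
    (x : (N → ℂ) × ({P : K // 0 < m P} → ℂ)) (P : {P : K // 0 < m P}) :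
    insertCoeffs κ hmt x (leadingIndex e t hmt P) = x.2 P := by
  have h : ∃ Q, leadingIndex e t hmt Q = leadingIndex e t hmt P := ⟨P, rfl⟩
  rw [insertCoeffs, dif_neg (not_isFreeIndex_leadingIndex hmt P), dif_pos h]
  exact congrArg x.2 (leadingIndex_injective he hmt h.choose_spec)

theorem insertCoeffs_of_lt (he : Function.Injective e)
    (x : (N → ℂ) × ({P : K // 0 < m P} → ℂ)) (P : {P : K // 0 < m P}) (k : Fin t)
    (hk : (k : ℕ) + 1 < m P.1) : insertCoeffs κ hmt x (e P, k) = 0 := by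
  have h1 : ¬ IsFreeIndex e t (e P, k) := fun h => by
    have := h P rfl
    simp only at this
    omega
  have h2 : ¬ ∃ Q, leadingIndex e t hmt Q = (e P, k) := by
    rintro ⟨Q, hQ⟩
    obtain rfl := he (congrArg Prod.fst hQ)
    have : m Q.1 - 1 = (k : ℕ) := congrArg (fun x : Fin n × Fin t => (x.2 : ℕ)) hQ
    omega
  rw [insertCoeffs, dif_neg h1, dif_neg h2]

/-- An index that is not free has degree at most `m P`: it is either leading or in the range where
`a` vanishes, so nothing is lost. -/
theorem insertCoeffs_eq {a : Fin n × Fin t → ℂ}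
    (ha : ∀ (P : {P : K // 0 < m P}) (k : Fin t), (k : ℕ) + 1 < m P.1 → a (e P, k) = 0) :
    insertCoeffs κ hmt (fun l => a (κ l), fun P => a (leadingIndex e t hmt P)) = a := by
  ext ik
  by_cases h : IsFreeIndex e t ik
  · rw [insertCoeffs, dif_pos h]
    exact congrArg (fun x => a x.1) (κ.apply_symm_apply ⟨ik, h⟩)
  · by_cases h' : ∃ P, leadingIndex e t hmt P = ik
    · rw [insertCoeffs, dif_neg h, dif_pos h']
      exact congrArg a h'.choose_spec
    · rw [insertCoeffs, dif_neg h, dif_neg h']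
      simp only [IsFreeIndex, not_forall, not_le] at h
      obtain ⟨P, hP, hk⟩ := h
      have hne : (ik.2 : ℕ) ≠ m P.1 - 1 := fun hne => h' ⟨P, Prod.ext hP (Fin.ext hne.symm)⟩
      exact (ha P ik.2 (by omega)).symm.trans (congrArg a (Prod.ext hP rfl))

theorem isRegularMapOn_insertCoeffs (S : Set ((N → ℂ) × ({P : K // 0 < m P} → ℂ))) :
    IsRegularMapOn (insertCoeffs κ hmt) S := by
  refine isRegularMapOn_pi fun x hx ik => ?_
  by_cases h : IsFreeIndex e t ik
  · refine ((isRegularMapOn_fst S).isRegularAt_comp hx (Set.mapsTo_univ _ _)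
      (isRegularAt_apply _ (κ.symm ⟨ik, h⟩) x.1)).congr fun a _ => ?_
    rw [insertCoeffs, dif_pos h, Function.comp_apply]
  · by_cases h' : ∃ P, leadingIndex e t hmt P = ik
    · refine ((isRegularMapOn_snd S).isRegularAt_comp hx (Set.mapsTo_univ _ _)
        (isRegularAt_apply _ h'.choose x.2)).congr fun a _ => ?_
      rw [insertCoeffs, dif_neg h, dif_pos h', Function.comp_apply]
    · refine (isRegularAt_const S 0 x).congr fun a _ => ?_
      rw [insertCoeffs, dif_neg h, dif_neg h']

end Free

/-! ### Jets with given contact orders on a chart -/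

section

variable {Y : Scheme.{0}} [Y.Over (Spec (.of ℂ))] {n : ℕ} {D : EffDivisor Y} (c : SNCChart n D)

/-- The jets over a chart with given contact orders along the components of `D`. -/
def SNCChart.contactJets (m : D.support → ℕ) (t : ℕ) : Set (Jet Y t) :=
  {γ | γ.base ∈ c.U} ∩ {γ | ∀ P : D.support, HasContact (Finsupp.single P.1 1) t (m P) γ}

theorem isConstructibleSet_contactJets (hD : IsSNC n D) {m : D.support → ℕ} {t : ℕ}
    (hmt : ∀ P, m P ≤ t) : IsConstructibleSet (c.contactJets m t) := by
  refine ((isZariskiLocallyClosed_jets_over c.U t).inter (IsZariskiLocallyClosed.setOf_forall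
    fun P => isZariskiLocallyClosed_hasContact (hmt P) fun y => ?_)).isConstructibleSet
  obtain ⟨c', hc'⟩ := hD y
  exact ⟨c'.U, _, hc', c'.isLocalEquation_component P⟩

theorem preimage_contactJets {m : D.support → ℕ} {t : ℕ} (hmt : ∀ P, m P ≤ t) :
    {γ : Arc Y | γ.base ∈ c.U ∧ ∀ P, contactOrder (Finsupp.single P.1 1) γ = m P} =
      truncArc t ⁻¹' c.contactJets m t := by
  ext γ
  change _ ↔ (truncArc t γ).base ∈ c.U ∧ ∀ P : D.support, _
  rw [base_truncArc]
  exact and_congr_right fun hU => forall_congr' fun P =>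
    (hasContact_truncArc_iff (hmt P) hU (c.isLocalEquation_component P)).symm

/-- Separates the constant coefficient of the equation, which depends only on the base point, from
the higher ones, which are coordinates of the trivialization. -/
theorem hasContact_component_iff {t : ℕ} {γ : Jet Y t} (hU : γ.base ∈ c.U) (P : D.support) {m : ℕ}
    (hm : m ≤ t) : HasContact (Finsupp.single P.1 1) t m γ ↔
      (γ.point.base ∈ P.1.carrier ↔ 0 < m) ∧
      ∀ h : ((P.1.carrier : Set Y) ∩ c.U).Nonempty,
        (∀ k : Fin t, (k : ℕ) + 1 < m → coordCoeffs c.U c.z t γ (c.e ⟨P, h⟩, k) = 0) ∧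
        ∀ h0 : 0 < m, coordCoeffs c.U c.z t γ (c.e ⟨P, h⟩, ⟨m - 1, by omega⟩) ≠ 0 := by
  have hU' : γ.point.base ∈ c.U := γ.base_point ▸ hU
  rw [hasContact_iff_coeffFun hm hU (c.isLocalEquation_component P),
    mem_carrier_iff (c.isLocalEquation_component P) hU', evalFun_point]
  -- For contact order zero the only condition is that the equation does not vanish at the base
  -- point.
  rcases m with _ | m
  · simp
  · constructor
    · rintro ⟨h1, h2⟩
      refine ⟨⟨fun _ => Nat.succ_pos m, fun _ => h1 0 (Nat.succ_pos m)⟩, fun h => ?_⟩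
      rw [c.component_of_nonempty h] at h2
      refine ⟨fun k hk => ?_, fun _ => h2⟩
      have := h1 _ hk
      rwa [c.component_of_nonempty h] at this
    · rintro ⟨h1, h2⟩
      have h0 := h1.mpr (Nat.succ_pos m)
      -- Positive contact puts the base point on `P`, so `P` meets the chart and its equation is a
      -- genuine coordinate.
      have h : ((P.1.carrier : Set Y) ∩ c.U).Nonempty := by
        rw [← evalFun_point, ← mem_carrier_iff (c.isLocalEquation_component P) hU'] at h0
        exact ⟨_, h0, hU'⟩
      obtain ⟨h3, h4⟩ := h2 h
      simp only [c.component_of_nonempty h] at h0 ⊢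
      refine ⟨fun i hi => ?_, h4 (Nat.succ_pos m)⟩
      rcases i with _ | i
      · exact h0
      · exact h3 ⟨i, by omega⟩ hi

theorem point_mem_openStratum {m : D.support → ℕ} {t : ℕ} (hmt : ∀ P, m P ≤ t) {γ : Jet Y t}
    (hγ : γ ∈ c.contactJets m t) :
    γ.point ∈ {y : CPoint Y | y.base ∈ c.U} ∩ openStratum D {P | 0 < m P} :=
  ⟨(γ.base_point ▸ hγ.1 : γ.point.base ∈ c.U),
    fun P => ((hasContact_component_iff c hγ.1 P (hmt P)).mp (hγ.2 P)).1⟩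

/-- The index of the coordinate that is an equation of `P`, for the components `P` with positive
contact order. -/
def SNCChart.index {m : D.support → ℕ}
    (hm : ∀ P : D.support, 0 < m P → ((P.1.carrier : Set Y) ∩ c.U).Nonempty)
    (P : {P : D.support // 0 < m P}) : Fin n := c.e ⟨P.1, hm P.1 P.2⟩

theorem SNCChart.index_injective {m : D.support → ℕ}
    (hm : ∀ P : D.support, 0 < m P → ((P.1.carrier : Set Y) ∩ c.U).Nonempty) :
    Function.Injective (c.index hm) := fun _ _ h =>
  Subtype.ext (congrArg (fun x => x.1) (c.e.injective h))

theorem mem_contactJets_iff {m : D.support → ℕ} {t : ℕ} (hmt : ∀ P, m P ≤ t)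
    (hm : ∀ P : D.support, 0 < m P → ((P.1.carrier : Set Y) ∩ c.U).Nonempty) {γ : Jet Y t} :
    γ ∈ c.contactJets m t ↔
      γ.point ∈ {y : CPoint Y | y.base ∈ c.U} ∩ openStratum D {P | 0 < m P} ∧
      ∀ P : {P // 0 < m P},
        (∀ k : Fin t, (k : ℕ) + 1 < m P.1 →
          coordCoeffs c.U c.z t γ (c.index hm P, k) = 0) ∧
        coordCoeffs c.U c.z t γ (leadingIndex (c.index hm) t hmt P) ≠ 0 := by
  constructor
  · refine fun hγ => ⟨point_mem_openStratum c hmt hγ, fun P => ?_⟩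
    have := ((hasContact_component_iff c hγ.1 P.1 (hmt P.1)).mp (hγ.2 P.1)).2 (hm P.1 P.2)
    exact ⟨this.1, this.2 P.2⟩
  · rintro ⟨⟨hU, hS⟩, h⟩
    have hU' : γ.base ∈ c.U := γ.base_point ▸ hU
    refine ⟨hU', fun P => (hasContact_component_iff c hU' P (hmt P)).mpr ⟨hS P, fun hP => ?_⟩⟩
    by_cases h0 : 0 < m P
    · exact ⟨(h ⟨P, h0⟩).1, fun _ => (h ⟨P, h0⟩).2⟩
    · exact ⟨fun k hk => absurd hk (by omega), fun h1 => absurd h1 h0⟩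

/-- The base point, the free coefficients and the leading coefficients of a jet. -/
noncomputable def freeTrivialization {m : D.support → ℕ} {t : ℕ} (hmt : ∀ P, m P ≤ t)
    (e : {P : D.support // 0 < m P} → Fin n) {N : Type} (κ : N ≃ {ik // IsFreeIndex e t ik})
    (γ : Jet Y t) : CPoint Y × ((N → ℂ) × ({P : D.support // 0 < m P} → ℂ)) :=
  (γ.point, (fun l => coordCoeffs c.U c.z t γ (κ l),
    fun P => coordCoeffs c.U c.z t γ (leadingIndex e t hmt P)))

/-- The inverse fills the constrained nonleading coefficients with zeros and takes the jet with
these coefficients; it is a composite of regular maps. -/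
theorem isIsoOn_freeTrivialization {m : D.support → ℕ} {t : ℕ} (hmt : ∀ P, m P ≤ t)
    (hm : ∀ P : D.support, 0 < m P → ((P.1.carrier : Set Y) ∩ c.U).Nonempty) {N : Type}
    (κ : N ≃ {ik // IsFreeIndex (c.index hm) t ik}) :
    IsIsoOn (freeTrivialization c hmt _ κ) (c.contactJets m t)
      (({y : CPoint Y | y.base ∈ c.U} ∩ openStratum D {P | 0 < m P}) ×ˢ
        ((Set.univ : Set (N → ℂ)) ×ˢ {w : {P // 0 < m P} → ℂ | ∀ P, w P ≠ 0})) := by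
  have he := c.index_injective hm
  let T : CPoint Y × ((N → ℂ) × ({P : D.support // 0 < m P} → ℂ)) →
    CPoint Y × (Fin n × Fin t → ℂ) := fun x => (x.1, insertCoeffs κ hmt x.2)
  have hcoeff : ∀ γ ∈ c.contactJets m t, ∀ ik,
      IsRegularAt (c.contactJets m t) (fun γ => coordCoeffs c.U c.z t γ ik) γ := fun γ hγ ik =>
    (isRegularAt_of_mem (mem_jetCharts Y t c.U) ⟨c.z ik.1, ik.2 + 1, ik.2.isLt, rfl⟩ hγ.1)
  have hφ : IsRegularMapOn (freeTrivialization c hmt _ κ) (c.contactJets m t) :=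
    (isRegularMapOn_point _).prodMk ((isRegularMapOn_pi fun γ hγ l => hcoeff γ hγ _).prodMk
      (isRegularMapOn_pi fun γ hγ P => hcoeff γ hγ _))
  have hT : ∀ S, IsRegularMapOn T S := fun S =>
    (isRegularMapOn_fst S).prodMk ((isRegularMapOn_insertCoeffs κ hmt Set.univ).comp
      (isRegularMapOn_snd S) (Set.mapsTo_univ _ _))
  have hspec : ∀ x : CPoint Y × ((N → ℂ) × ({P : D.support // 0 < m P} → ℂ)), x.1.base ∈ c.U →
      (jetOfCoeffs c.U c.z t (T x)).point = x.1 ∧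
        coordCoeffs c.U c.z t (jetOfCoeffs c.U c.z t (T x)) = insertCoeffs κ hmt x.2 :=
    fun x hx => jetOfCoeffs_spec c.coord t (x := T x) hx
  refine ⟨hφ.isMorphismOn fun γ hγ => ?_, jetOfCoeffs c.U c.z t ∘ T,
    ((isRegularMapOn_jetOfCoeffs c.coord t).comp (hT _) fun x hx =>
      ⟨hx.1.1, trivial⟩).isMorphismOn fun x hx => ?_, fun γ hγ => ?_, fun x hx => ?_⟩
  · obtain ⟨h1, h2⟩ := (mem_contactJets_iff c hmt hm).mp hγ
    exact ⟨h1, trivial, fun P => (h2 P).2⟩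
  · obtain ⟨h1, h2⟩ := hspec x hx.1.1
    rw [Function.comp_apply, mem_contactJets_iff c hmt hm, h1, h2]
    refine ⟨hx.1, fun P => ⟨fun k hk => insertCoeffs_of_lt κ hmt he x.2 P k hk, ?_⟩⟩
    rw [insertCoeffs_leadingIndex κ hmt he]
    exact hx.2.2 P
  · obtain ⟨h1, h2⟩ := (mem_contactJets_iff c hmt hm).mp hγ
    have h3 : T (freeTrivialization c hmt _ κ γ) = (γ.point, coordCoeffs c.U c.z t γ) :=
      Prod.ext rfl (insertCoeffs_eq κ hmt fun P => (h2 P).1)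
    rw [Function.comp_apply, h3, jetOfCoeffs_coordCoeffs c.coord t hγ.1]
  · obtain ⟨h1, h2⟩ := hspec x hx.1.1
    refine Prod.ext h1 (Prod.ext ?_ ?_)
    · ext l
      exact (congrFun h2 _).trans (insertCoeffs_free κ hmt x.2 l)
    · ext P
      exact (congrFun h2 _).trans (insertCoeffs_leadingIndex κ hmt he x.2 P)

/-- The inverse has to be a total function, so some map `ψ` is needed even between empty sets. -/
theorem isIsoOn_empty {X X' : Type} [ZariskiCharts X] [ZariskiCharts X'] [DirectedCharts X]
    [DirectedCharts X'] (φ : X → X') (ψ : X' → X) : IsIsoOn φ ∅ ∅ :=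
  ⟨IsRegularMapOn.isMorphismOn (fun _ h => h.elim) (Set.mapsTo_empty _ _), ψ,
    IsRegularMapOn.isMorphismOn (fun _ h => h.elim) (Set.mapsTo_empty _ _),
    fun _ h => h.elim, fun _ h => h.elim⟩

end

end ArcSpace

/-! ### The theorem -/

open ArcSpace
theorem mainTheorem10 (n : ℕ) (Y : Scheme.{0}) [Y.Over (Spec (.of ℂ))]
    [SmoothOfRelativeDimension n (Y ↘ Spec (.of ℂ))] [QuasiCompact (Y ↘ Spec (.of ℂ))]
    (D : EffDivisor Y) (hD : IsSNC n D) :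
    -- the level sets of `F_D`, and the pieces that partition them, are cylinder sets
    (∀ s : ℕ, IsCylinder {γ : Arc Y | contactOrder D γ = s}) ∧
    (∀ m : D.support → ℕ,
      IsCylinder {γ : Arc Y | ∀ P, contactOrder (Finsupp.single P.1 1) γ = m P}) ∧
    -- the explicit description on each coordinate chart adapted to `D`
    ∀ c : SNCChart n D,
      (∀ t : ℕ, IsIsoOn (c.trivialization t) {γ : Jet Y t | γ.base ∈ c.U}
        ({y : CPoint Y | y.base ∈ c.U} ×ˢ (Set.univ : Set (Fin n × Fin t → ℂ)))) ∧
      ∀ (m : D.support → ℕ) (t : ℕ) (hmt : ∀ P, m P ≤ t),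
        -- the exponent `t * n - ∑ P, m P` is nonnegative unless both sides are empty
        (({y : CPoint Y | y.base ∈ c.U} ∩ openStratum D {P | 0 < m P}).Nonempty →
          ∑ P, m P ≤ t * n) ∧
        ∃ B : Set (Jet Y t), IsConstructibleSet B ∧
          {γ : Arc Y | γ.base ∈ c.U ∧ ∀ P, contactOrder (Finsupp.single P.1 1) γ = m P} =
            truncArc t ⁻¹' B ∧
          ∃ φ : Jet Y t →
              CPoint Y × ((Fin (t * n - ∑ P, m P) → ℂ) × ({P : D.support // 0 < m P} → ℂ)),
            IsIsoOn φ B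
              (({y : CPoint Y | y.base ∈ c.U} ∩ openStratum D {P | 0 < m P}) ×ˢ
                ((Set.univ : Set (Fin (t * n - ∑ P, m P) → ℂ)) ×ˢ {w | ∀ P, w P ≠ 0})) ∧
            -- the components of `φ` are the base point and coordinates of the trivialization
            (∀ γ ∈ B, (φ γ).1 = γ.point) ∧
            (∀ l, ∃ ik : Fin n × Fin t, ∀ γ ∈ B, (φ γ).2.1 l = (c.trivialization t γ).2 ik) ∧
            (∀ (P : {P : D.support // 0 < m P})
              (hP : ((P.1.1.carrier : Set Y) ∩ c.U).Nonempty), ∀ γ ∈ B,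
              (φ γ).2.2 P = (c.trivialization t γ).2
                (c.e ⟨P.1, hP⟩, ⟨m P.1 - 1, by have := P.2; have := hmt P.1; omega⟩)) := by
  refine ⟨fun s => isCylinder_contactOrder s fun y => ?_, isCylinder_iInter_contactOrder hD,
    fun c => ⟨isIsoOn_trivialization c, fun m t hmt => ?_⟩⟩
  · obtain ⟨c, hc⟩ := hD y
    exact ⟨c.U, _, hc, isLocalEquation_prod c.component c.isLocalEquation_component⟩
  by_cases hS : ({y : CPoint Y | y.base ∈ c.U} ∩ openStratum D {P | 0 < m P}).Nonempty
  · obtain ⟨y, hyU, hy⟩ := hS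
    -- A point of the stratum in the chart witnesses that every component with positive contact
    -- order has an index under `c.e`.
    have hm : ∀ P : D.support, 0 < m P → ((P.1.carrier : Set Y) ∩ c.U).Nonempty :=
      fun P hP => ⟨y.base, (hy P).mpr hP, hyU⟩
    have hcard := card_isFreeIndex (c.index_injective hm) hmt
    have hfin : Nat.card (Fin (t * n - ∑ P, m P)) =
        Nat.card {ik // IsFreeIndex (c.index hm) t ik} := by
      rw [Nat.card_fin]
      omega
    obtain ⟨κ⟩ := Finite.card_eq.mp hfin
    exact ⟨fun _ => by omega, c.contactJets m t, isConstructibleSet_contactJets c hD hmt,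
      preimage_contactJets c hmt, freeTrivialization c hmt _ κ,
      isIsoOn_freeTrivialization c hmt hm κ, fun _ _ => rfl, fun l => ⟨_, fun _ _ => rfl⟩,
      fun _ _ _ _ => rfl⟩
  · have hB : c.contactJets m t = ∅ := Set.eq_empty_of_forall_notMem fun γ hγ =>
      hS ⟨_, point_mem_openStratum c hmt hγ⟩
    refine ⟨fun h => absurd h hS, c.contactJets m t, isConstructibleSet_contactJets c hD hmt,
      preimage_contactJets c hmt, fun γ => (γ.point, 0), ?_, fun _ _ => rfl, fun l => ?_, ?_⟩
    · rw [hB, Set.not_nonempty_iff_eq_empty.mp hS, Set.empty_prod]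
      exact isIsoOn_empty _ fun x => x.1.map (Algebra.ofId ℂ (JetRing t))
    -- Both sides are empty, so any index will do; the existence of `l` ensures that there is one.
    · have hl : 0 < t * n := by have := l.isLt; omega
      refine ⟨(⟨0, Nat.pos_of_mul_pos_left hl⟩, ⟨0, Nat.pos_of_mul_pos_right hl⟩), ?_⟩
      rw [hB]
      exact fun _ h => h.elim
    · rw [hB]
      exact fun _ _ _ h => h.elim
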